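/- **Equidistribution at logarithmical scales.** Let $M\in\mathrm{SL}(2,\mathbb Z)$ with $|\mathrm{Tr}\,M|>2$. Write $M=\varepsilon\exp\begin{pmatrix} c & b\\ -a & -c\end{pmatrix}$ with $\varepsilon\in\{1,-1\}$, $a,b,c\in\mathbb R$ and $ab<c^2$. For an integer $N\ge1$ put $h=1/N$, let $\hat q f(q)=qf(q)$, $\hat p=\frac{h}{2\pi i}\frac{d}{dq}$, and $\hat H=\frac12a\hat q^2+\frac12b\hat p^2+\frac c2(\hat q\hat p+\hat p\hat q)$. Let $e^{-2\pi i\hat H/h}$ be the time-one map of the Schrödinger equation $\frac{ih}{2\pi}\partial_t\psi=\hat H\psi$ on $\mathcal S(\mathbb R)$, and let $\hat M=e^{-2\pi i\hat H/h}$ if $\varepsilon=1$, and $\hat M=R\,e^{-2\pi i\hat H/h}$ with $(Rf)(q)=f(-q)$ if $\varepsilon=-1$. Extend $\hat M$ to tempered distributions by duality, $\langle\hat M\psi,\hat Mf\rangle=\langle\psi,f\rangle$ for all $f\in\mathcal S(\mathbb R)$. For $\kappa=(\kappa_1,\kappa_2)\in\mathbb R^2$ let $\mathcal H_{N,\kappa}$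 be the $N$-dimensional space of distributions $$\psi=\sum_{k\in\mathbb Z}\Psi(k)\,\delta\bigl(q-(k+\kappa_1)/N\bigr),\qquad \Psi(k+N)=e^{-2\pi i\kappa_2}\Psi(k),$$ with inner product $\langle\psi,\phi\rangle=\frac1N\sum_{k=1}^N\Psi(k)\overline{\Phi(k)}$. For such $\psi$ and a ball $B\subset\mathbb T^1=\mathbb R/\mathbb Z$ let $$\int_B|\psi|^2\,d\mathrm{Vol}:=\frac1N\sum_{\substack{1\le k\le N\\ (k+\kappa_1)/N\,\in\,B\ (\mathrm{mod}\ 1)}}|\Psi(k)|^2 .$$ Let $0\le\alpha<1/2$ and $r=r(N)=(\log N)^{-\alpha}$. For each $N\ge1$ let $\kappa=\kappa(N)$ be such that $\hat M$ maps $\mathcal H_N:=\mathcal H_{N,\kappa}$ to itself, and let $\{\phi_j\}_{j=1}^N=\{\phi_j^{(N)}\}_{j=1}^N$ be any orthonormal basis of $\mathcal H_N$ with $\hat M\phi_j=e^{i\theta_j}\phi_j$, $\theta_j\in\mathbb R$. Then there are subsets $S(N)\subset\{1,\dots,N\}$ with $\#S(N)/N\to1$ as $N\to\infty$ such that $$\int_{B_1(q,r)}|\phi_j|^2\,d\mathrm{Vol}=\mathrm{Vol}(B_1(q,r))+o(r)\qquad\text{as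 }N\to\infty,$$ uniformly for all $j\in S(N)$ and all $q\in\mathbb T^1$, where $B_1(q,r)$ is the open ball in $\mathbb T^1$ and $\mathrm{Vol}$ its length. -/

import Mathlib

open scoped SchwartzMap FourierTransform ENNReal Topology ComplexConjugate
open MeasureTheory Filter

noncomputable section

namespace QuantumCat

/-! ### The quantized quadratic Hamiltonian on the line, with Planck constant `h = 1 / N` -/

/-- The position operator `f(q) ↦ q f(q)`. -/
def posOp : 𝓢(ℝ, ℂ) →L[ℂ] 𝓢(ℝ, ℂ) :=
  SchwartzMap.smulLeftCLM ℂ (fun q : ℝ => (q : ℂ))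

/-- The momentum operator `(h / 2πi) d/dq` with `h = 1 / N`. -/
def momOp (N : ℕ) : 𝓢(ℝ, ℂ) →L[ℂ] 𝓢(ℝ, ℂ) :=
  (1 / (2 * Real.pi * Complex.I * N) : ℂ) • SchwartzMap.derivCLM ℂ ℂ

/-- The Weyl quantization of `H(q, p) = a q² / 2 + b p² / 2 + c q p`. -/
def hamOp (N : ℕ) (a b c : ℝ) : 𝓢(ℝ, ℂ) →L[ℂ] 𝓢(ℝ, ℂ) :=
  (a / 2 : ℂ) • posOp.comp posOp + (b / 2 : ℂ) • (momOp N).comp (momOp N) +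
    (c / 2 : ℂ) • (posOp.comp (momOp N) + (momOp N).comp posOp)

/-- `ψ` solves the Schrödinger equation `(i h / 2π) ∂ψ/∂t = Ĥ ψ`, where the time derivative is
taken in `L²(ℝ)`; that is, `dψ/dt = (2π N / i) Ĥ ψ`. -/
def IsSchrodingerSolution (N : ℕ) (a b c : ℝ) (ψ : ℝ → 𝓢(ℝ, ℂ)) : Prop :=
  ∀ t : ℝ, HasDerivAt (fun s => (ψ s).toLp 2 volume)
    ((2 * Real.pi * N / Complex.I : ℂ) • (hamOp N a b c (ψ t)).toLp 2 volume) t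

/-! ### Existence and uniqueness of solutions of the Schrödinger equation -/

theorem hasTemperateGrowth_coe : (fun q : ℝ => (q : ℂ)).HasTemperateGrowth :=
  Complex.ofRealCLM.hasTemperateGrowth

theorem posOp_apply (f : 𝓢(ℝ, ℂ)) (q : ℝ) : posOp f q = q * f q := by
  simp [posOp, SchwartzMap.smulLeftCLM_apply_apply hasTemperateGrowth_coe]

def chirpFun (s : ℝ) (q : ℝ) : ℂ := Complex.exp (Complex.I * (s * q ^ 2 : ℝ))

theorem chirp_deriv (s q : ℝ) : HasDerivAt (chirpFun s) ((2 * Complex.I * s * q) * chirpFun s q) q := by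
  unfold chirpFun
  have h1 : HasDerivAt (fun q : ℝ => ((s * q ^ 2 : ℝ) : ℂ)) ((s * (2 * q) : ℝ) : ℂ) q := by
    have := ((hasDerivAt_pow 2 q).const_mul s).ofReal_comp
    simpa using this
  have := (h1.const_mul Complex.I).cexp
  convert this using 1
  push_cast; ring

theorem norm_chirp (s q : ℝ) : ‖chirpFun s q‖ = 1 := by
  unfold chirpFun
  rw [mul_comm, Complex.norm_exp_ofReal_mul_I]

theorem chirp_growth (s : ℝ) : (chirpFun s).HasTemperateGrowth := by
  have hexp : (fun x : ℝ => Complex.exp (Complex.I * x)).HasTemperateGrowth := by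
    have hder : ∀ x : ℝ, HasDerivAt (fun x : ℝ => Complex.exp (Complex.I * x))
        (Complex.I * Complex.exp (Complex.I * x)) x := by
      intro x
      have := ((Complex.ofRealCLM.hasDerivAt (x := x)).const_mul Complex.I).cexp
      simpa [mul_comm] using this
    have hit : ∀ n : ℕ, iteratedDeriv n (fun x : ℝ => Complex.exp (Complex.I * x)) =
        fun x : ℝ => Complex.I ^ n * Complex.exp (Complex.I * x) := by
      intro n
      induction n with
      | zero => simp
      | succ n ih =>
        rw [iteratedDeriv_succ, ih]
        ext x
        rw [((hder x).const_mul _).deriv]; ring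
    refine ⟨(contDiff_const.mul Complex.ofRealCLM.contDiff).cexp, fun n => ⟨0, 1, fun x => ?_⟩⟩
    rw [norm_iteratedFDeriv_eq_norm_iteratedDeriv, hit]
    simp [mul_comm Complex.I, Complex.norm_exp_ofReal_mul_I]
  have h2 : (fun q : ℝ => s * q ^ 2).HasTemperateGrowth := by
    have := (Function.HasTemperateGrowth.const (E := ℝ) s).mul
      (Function.HasTemperateGrowth.id (E := ℝ) |>.pow 2)
    exact this
  exact hexp.comp h2

def chirp (s : ℝ) : 𝓢(ℝ, ℂ) →L[ℂ] 𝓢(ℝ, ℂ) := SchwartzMap.smulLeftCLM ℂ (chirpFun s)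

theorem chirp_apply (s : ℝ) (f : 𝓢(ℝ, ℂ)) (q : ℝ) : chirp s f q = chirpFun s q * f q := by
  simp [chirp, SchwartzMap.smulLeftCLM_apply_apply (chirp_growth s)]

theorem chirp_neg_apply (s : ℝ) (f : 𝓢(ℝ, ℂ)) : chirp s (chirp (-s) f) = f := by
  ext q
  rw [chirp_apply, chirp_apply, ← mul_assoc, chirpFun, chirpFun, ← Complex.exp_add]
  simp

theorem posOp_chirp (s : ℝ) (f : 𝓢(ℝ, ℂ)) : posOp (chirp s f) = chirp s (posOp f) := by
  ext q
  simp only [posOp_apply, chirp_apply]; ring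

abbrev dOp : 𝓢(ℝ, ℂ) →L[ℂ] 𝓢(ℝ, ℂ) := SchwartzMap.derivCLM ℂ ℂ

theorem dOp_chirp (s : ℝ) (f : 𝓢(ℝ, ℂ)) :
    dOp (chirp s f) = chirp s (dOp f + (2 * Complex.I * s) • posOp f) := by
  ext q
  have h1 : HasDerivAt (fun x => chirp s f x)
      ((2 * Complex.I * s * q) * chirpFun s q * f q + chirpFun s q * deriv f q) q := by
    have := (chirp_deriv s q).mul (f.hasDerivAt q)
    refine this.congr_of_eventuallyEq (Eventually.of_forall fun x => ?_)
    simp [chirp_apply]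
  rw [SchwartzMap.derivCLM_apply, h1.deriv, chirp_apply]
  simp [posOp_apply]; ring

theorem dOp_posOp (f : 𝓢(ℝ, ℂ)) : dOp (posOp f) = f + posOp (dOp f) := by
  ext q
  have h1 : HasDerivAt (fun x => posOp f x) (1 * f q + (q : ℂ) * deriv f q) q := by
    have := (Complex.ofRealCLM.hasDerivAt (x := q)).mul (f.hasDerivAt q)
    refine (this.congr_of_eventuallyEq (Eventually.of_forall fun x => ?_)).congr_deriv ?_
    · simp [posOp_apply]
    · simp
  rw [SchwartzMap.derivCLM_apply, h1.deriv]
  simp [posOp_apply]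

open LineDeriv in
theorem lineDeriv_one (f : 𝓢(ℝ, ℂ)) : ∂_{(1 : ℝ)} f = dOp f := by
  ext x
  rw [SchwartzMap.lineDerivOp_apply_eq_fderiv, SchwartzMap.derivCLM_apply]
  simp

theorem smulInner_eq (f : 𝓢(ℝ, ℂ)) :
    SchwartzMap.smulLeftCLM ℂ (fun x : ℝ => inner ℝ x (1 : ℝ)) f = posOp f := by
  ext x
  have : (fun x : ℝ => inner ℝ x (1 : ℝ)).HasTemperateGrowth := by fun_prop
  rw [SchwartzMap.smulLeftCLM_apply_apply this, posOp_apply]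
  simp

theorem dOp_fourierInv (f : 𝓢(ℝ, ℂ)) :
    dOp (𝓕⁻ f) = (2 * Real.pi * Complex.I : ℂ) • 𝓕⁻ (posOp f) := by
  have := SchwartzMap.lineDerivOp_fourierInv_eq f (1 : ℝ)
  rw [lineDeriv_one] at this
  rw [this, ← FourierTransform.fourierInv_smul, smulInner_eq]

theorem posOp_fourierInv (f : 𝓢(ℝ, ℂ)) :
    posOp (𝓕⁻ f) = (-(2 * Real.pi * Complex.I : ℂ)⁻¹) • 𝓕⁻ (dOp f) := by
  have := SchwartzMap.fourierInv_lineDerivOp_eq f (1 : ℝ)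
  rw [lineDeriv_one, smulInner_eq] at this
  rw [this, smul_smul]
  have : (2 * Real.pi * Complex.I : ℂ) ≠ 0 := by simp [Real.pi_ne_zero]
  rw [neg_mul_neg, inv_mul_cancel₀ this, one_smul]

def invF : 𝓢(ℝ, ℂ) →L[ℂ] 𝓢(ℝ, ℂ) := FourierTransform.fourierInvCLM ℂ 𝓢(ℝ, ℂ)

theorem invF_apply (f : 𝓢(ℝ, ℂ)) : invF f = 𝓕⁻ f := rfl

def conjOp (s r : ℝ) : 𝓢(ℝ, ℂ) →L[ℂ] 𝓢(ℝ, ℂ) := (chirp s).comp (invF.comp (chirp r))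

def qT (r : ℝ) : 𝓢(ℝ, ℂ) →L[ℂ] 𝓢(ℝ, ℂ) :=
  (-(2 * Real.pi * Complex.I : ℂ)⁻¹) • (dOp + (2 * Complex.I * r : ℂ) • posOp)

def dT (s r : ℝ) : 𝓢(ℝ, ℂ) →L[ℂ] 𝓢(ℝ, ℂ) :=
  (2 * Real.pi * Complex.I : ℂ) • posOp + (2 * Complex.I * s : ℂ) • qT r

theorem posOp_conjOp (s r : ℝ) (f : 𝓢(ℝ, ℂ)) : posOp (conjOp s r f) = conjOp s r (qT r f) := by
  simp only [conjOp, ContinuousLinearMap.comp_apply, posOp_chirp, invF_apply, posOp_fourierInv,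
    dOp_chirp, qT]
  rw [← invF_apply, ← invF_apply]
  simp only [map_smul, smul_apply, add_apply]

theorem dOp_conjOp (s r : ℝ) (f : 𝓢(ℝ, ℂ)) : dOp (conjOp s r f) = conjOp s r (dT s r f) := by
  have h := posOp_conjOp s r f
  simp only [conjOp, ContinuousLinearMap.comp_apply] at h ⊢
  rw [dOp_chirp, map_add, map_smul, ← posOp_chirp, h, invF_apply, dOp_fourierInv, posOp_chirp,
    ← invF_apply]
  simp only [map_smul, map_add, dT, smul_apply, add_apply]

/-- generator of dilations -/
def dilGen : 𝓢(ℝ, ℂ) →L[ℂ] 𝓢(ℝ, ℂ) := (1 / 2 : ℂ) • ContinuousLinearMap.id ℂ _ + posOp.comp dOp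

theorem ham_conjOp {N : ℕ} (hN : 1 ≤ N) {a b c k : ℝ} (hk : b * k ^ 2 + 2 * c * k + a = 0)
    (hm : c + b * k ≠ 0) (f : 𝓢(ℝ, ℂ)) :
    (2 * Real.pi * N / Complex.I : ℂ) • hamOp N a b c
      (conjOp (Real.pi * N * k) (Real.pi * b / (2 * N * (c + b * k))) f) =
    conjOp (Real.pi * N * k) (Real.pi * b / (2 * N * (c + b * k))) (((c + b * k : ℝ) : ℂ) • dilGen f) := by
  have hN' : (N : ℂ) ≠ 0 := by exact_mod_cast (by omega : N ≠ 0)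
  have hpi : (Real.pi : ℂ) ≠ 0 := by exact_mod_cast Real.pi_ne_zero
  have hm' : (c + b * k : ℂ) ≠ 0 := by exact_mod_cast hm
  have hk' : (b * k ^ 2 + 2 * c * k + a : ℂ) = 0 := by exact_mod_cast hk
  simp only [hamOp, momOp, ContinuousLinearMap.comp_apply, smul_apply,
    add_apply, map_smul, posOp_conjOp, dOp_conjOp]
  simp only [← map_smul, ← map_add]
  congr 1
  ext x
  simp only [dT, qT, dilGen, dOp_posOp, ContinuousLinearMap.comp_apply,
    smul_apply, add_apply, map_smul, map_add,
    posOp_apply, smul_eq_mul,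
    ContinuousLinearMap.id_apply]
  generalize dOp (dOp f) x = f2
  generalize dOp f x = f1
  generalize f x = f0
  have ha : (a : ℂ) = -(b * k ^ 2 + 2 * c * k) := by linear_combination hk'
  rw [ha]
  push_cast
  field_simp
  grind [Complex.I_sq]

theorem normSq_toLp (f : 𝓢(ℝ, ℂ)) : ‖f.toLp 2 volume‖ ^ 2 = ∫ x, ‖f x‖ ^ 2 := by
  rw [SchwartzMap.norm_toLp' (by simp) (by simp)]
  have h0 : 0 ≤ ∫ x, ‖f x‖ ^ 2 := integral_nonneg fun _ => by positivity
  simp only [ENNReal.toReal_ofNat, Real.rpow_two]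
  rw [← Real.rpow_natCast, ← Real.rpow_mul h0]
  norm_num

def scaleEquiv (t : ℝ) : ℝ ≃L[ℝ] ℝ :=
  ContinuousLinearEquiv.unitsEquivAut ℝ (Units.mk0 (Real.exp t) (Real.exp_ne_zero t))

def dil (t : ℝ) : 𝓢(ℝ, ℂ) →L[ℂ] 𝓢(ℝ, ℂ) :=
  (Real.exp (t / 2) : ℂ) • SchwartzMap.compCLMOfContinuousLinearEquiv ℂ (scaleEquiv t)

theorem dil_apply (t : ℝ) (f : 𝓢(ℝ, ℂ)) (x : ℝ) :
    dil t f x = Real.exp (t / 2) * f (Real.exp t * x) := by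
  simp [dil, scaleEquiv, mul_comm x]

theorem dil_add (s t : ℝ) (f : 𝓢(ℝ, ℂ)) : dil t (dil s f) = dil (t + s) f := by
  ext x
  simp only [dil_apply]
  rw [← mul_assoc, ← mul_assoc, ← Complex.ofReal_mul, ← Real.exp_add, ← Real.exp_add]
  ring_nf

theorem dil_zero (f : 𝓢(ℝ, ℂ)) : dil 0 f = f := by
  ext x; simp [dil_apply]

theorem norm_dil (t : ℝ) (f : 𝓢(ℝ, ℂ)) : ‖(dil t f).toLp 2 volume‖ = ‖f.toLp 2 volume‖ := by
  rw [← sq_eq_sq₀ (norm_nonneg _) (norm_nonneg _), normSq_toLp, normSq_toLp]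
  have h : ∀ x, ‖dil t f x‖ ^ 2 = Real.exp t * ‖f (Real.exp t * x)‖ ^ 2 := by
    intro x
    rw [dil_apply, norm_mul, mul_pow, Complex.norm_real, Real.norm_eq_abs, sq_abs, ← Real.exp_nat_mul]
    congr 2; push_cast; ring
  simp_rw [h]
  rw [integral_const_mul, Measure.integral_comp_mul_left (fun y => ‖f y‖ ^ 2), smul_eq_mul,
    abs_of_pos (by positivity), mul_inv_cancel_left₀ (Real.exp_ne_zero t)]

theorem norm_chirp_toLp (s : ℝ) (f : 𝓢(ℝ, ℂ)) :
    ‖(chirp s f).toLp 2 volume‖ = ‖f.toLp 2 volume‖ := by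
  rw [← sq_eq_sq₀ (norm_nonneg _) (norm_nonneg _), normSq_toLp, normSq_toLp]
  simp [chirp_apply, norm_chirp]

theorem norm_invF_toLp (f : 𝓢(ℝ, ℂ)) : ‖(invF f).toLp 2 volume‖ = ‖f.toLp 2 volume‖ := by
  rw [invF_apply, ← SchwartzMap.toLp_fourierInv_eq, ← Lp.norm_fourier_eq,
    FourierTransform.fourier_fourierInv_eq]

theorem norm_conjOp_toLp (s r : ℝ) (f : 𝓢(ℝ, ℂ)) :
    ‖(conjOp s r f).toLp 2 volume‖ = ‖f.toLp 2 volume‖ := by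
  simp [conjOp, norm_chirp_toLp, norm_invF_toLp]

theorem toLp_eq (f : 𝓢(ℝ, ℂ)) : f.toLp 2 volume = SchwartzMap.toLpCLM ℂ ℂ 2 volume f := rfl

theorem hasDerivAt_iso {V : 𝓢(ℝ, ℂ) →L[ℂ] 𝓢(ℝ, ℂ)}
    (hV : ∀ f, ‖(V f).toLp 2 volume‖ = ‖f.toLp 2 volume‖) {ψ : ℝ → 𝓢(ℝ, ℂ)} {g : 𝓢(ℝ, ℂ)} {t : ℝ}
    (h : HasDerivAt (fun s => (ψ s).toLp 2 volume) (g.toLp 2 volume) t) :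
    HasDerivAt (fun s => (V (ψ s)).toLp 2 volume) ((V g).toLp 2 volume) t := by
  rw [hasDerivAt_iff_tendsto] at h ⊢
  refine h.congr fun s => ?_
  congr 1
  have := hV (ψ s - ψ t - ((s - t : ℝ) : ℂ) • g)
  simp only [toLp_eq, map_sub, map_smul] at this ⊢
  exact this.symm

theorem decay_bound (g : 𝓢(ℝ, ℂ)) : ∃ C, 0 < C ∧ ∀ y, ‖g y‖ ≤ C / (1 + y ^ 2) := by
  obtain ⟨C0, h0, hC0⟩ := g.decay 0 0
  obtain ⟨C2, h2, hC2⟩ := g.decay 2 0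
  refine ⟨C0 + C2, by positivity, fun y => ?_⟩
  rw [le_div_iff₀ (by positivity)]
  have e0 := hC0 y
  have e2 := hC2 y
  simp at e0 e2
  nlinarith

theorem dil_bound (g : 𝓢(ℝ, ℂ)) :
    ∃ C, 0 < C ∧ ∀ t, |t| ≤ 1 → ∀ x, ‖dil t g x‖ ≤ C / (1 + x ^ 2) := by
  obtain ⟨C, hC, hg⟩ := decay_bound g
  refine ⟨Real.exp 1 * (C * Real.exp 2), by positivity, fun t ht x => ?_⟩
  rw [dil_apply, norm_mul, Complex.norm_real, Real.norm_of_nonneg (Real.exp_pos _).le, mul_div_assoc]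
  obtain ⟨h1, h2⟩ := abs_le.mp ht
  refine mul_le_mul (Real.exp_le_exp.2 (by linarith)) ((hg _).trans ?_) (norm_nonneg _) (by positivity)
  rw [div_le_div_iff₀ (by positivity) (by positivity), mul_assoc]
  refine mul_le_mul_of_nonneg_left ?_ hC.le
  have e : 1 ≤ Real.exp 2 := Real.one_le_exp (by norm_num)
  have e' : 1 ≤ Real.exp 2 * Real.exp t ^ 2 := by
    rw [← Real.exp_nat_mul, ← Real.exp_add]
    exact Real.one_le_exp (by push_cast; linarith)
  nlinarith [mul_le_mul_of_nonneg_right e' (sq_nonneg x)]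

theorem dil_pointwise (f : 𝓢(ℝ, ℂ)) (x t : ℝ) :
    HasDerivAt (fun s => dil s f x) (dil t (dilGen f) x) t := by
  simp only [dil_apply]
  have h1 : HasDerivAt (fun s : ℝ => ((Real.exp (s / 2) : ℝ) : ℂ)) ((Real.exp (t / 2) * (1 / 2) : ℝ) : ℂ) t :=
    (((hasDerivAt_id t).div_const 2).exp).ofReal_comp
  have h2 : HasDerivAt (fun s : ℝ => f (Real.exp s * x)) ((Real.exp t * x) • deriv f (Real.exp t * x)) t :=
    HasDerivAt.scomp t (f.hasDerivAt _) ((Real.hasDerivAt_exp t).mul_const x)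
  refine (h1.mul h2).congr_deriv ?_
  simp [dilGen, posOp_apply]
  ring

theorem dil_hasDerivAt_zero (f : 𝓢(ℝ, ℂ)) :
    HasDerivAt (fun s => (dil s f).toLp 2 volume) ((dilGen f).toLp 2 volume) 0 := by
  obtain ⟨C, hC, hb⟩ := dil_bound (dilGen f)
  have key : ∀ s, |s| ≤ 1 → ∀ x, ‖dil s f x - f x - s * dilGen f x‖ ≤ |s| * (2 * C / (1 + x ^ 2)) := by
    intro s hs x
    have := Convex.norm_image_sub_le_of_norm_hasDerivWithin_le
      (f := fun τ : ℝ => dil τ f x - τ * dilGen f x)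
      (f' := fun τ => dil τ (dilGen f) x - dilGen f x) (s := Set.Icc (-1) 1) (x := 0) (y := s)
      (C := 2 * C / (1 + x ^ 2)) (fun τ _ => ?_) (fun τ hτ => ?_) (convex_Icc _ _) (by simp)
      (abs_le.mp hs)
    · simp only [dil_zero, Complex.ofReal_zero, zero_mul, sub_zero, Real.norm_eq_abs] at this
      rw [mul_comm |s|]
      have e : dil s f x - f x - s * dilGen f x = dil s f x - s * dilGen f x - f x := by ring
      rw [e]
      exact this
    · have h3 : HasDerivAt (fun τ : ℝ => (τ : ℂ) * dilGen f x) (dilGen f x) τ := by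
        simpa using (Complex.ofRealCLM.hasDerivAt (x := τ)).mul_const (dilGen f x)
      exact ((dil_pointwise f x τ).sub h3).hasDerivWithinAt
    · refine (norm_sub_le _ _).trans ?_
      have e1 := hb τ (abs_le.mpr hτ) x
      have e2 := hb 0 (by simp) x
      rw [dil_zero] at e2
      have : 2 * C / (1 + x ^ 2) = C / (1 + x ^ 2) + C / (1 + x ^ 2) := by ring
      linarith
  rw [hasDerivAt_iff_tendsto]
  have hsq : ∀ s : ℝ, (‖s - 0‖⁻¹ * ‖(dil s f).toLp 2 volume - (dil 0 f).toLp 2 volume -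
      (s - 0) • (dilGen f).toLp 2 volume‖) ^ 2 =
      ∫ x, (|s|⁻¹ * ‖dil s f x - f x - s * dilGen f x‖) ^ 2 := by
    intro s
    have := normSq_toLp (dil s f - f - (s : ℂ) • dilGen f)
    simp only [toLp_eq, map_sub, map_smul] at this ⊢
    rw [mul_pow, sub_zero, dil_zero, Real.norm_eq_abs]
    have e : (s • (SchwartzMap.toLpCLM ℂ ℂ 2 volume) (dilGen f)) =
      ((s : ℂ) • (SchwartzMap.toLpCLM ℂ ℂ 2 volume) (dilGen f)) := rfl
    rw [e, this, ← integral_const_mul]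
    simp [mul_pow]
  have hlim : Tendsto (fun s : ℝ => ∫ x, (|s|⁻¹ * ‖dil s f x - f x - s * dilGen f x‖) ^ 2)
      (𝓝 0) (𝓝 (∫ x : ℝ, (0 : ℝ))) := by
    refine tendsto_integral_filter_of_dominated_convergence (fun x => (2 * C) ^ 2 * (1 + x ^ 2)⁻¹) ?_ ?_ ?_ ?_
    · refine Eventually.of_forall fun s => Continuous.aestronglyMeasurable ?_
      have := (dil s f).continuous
      have := f.continuous
      have := (dilGen f).continuous
      fun_prop
    · have : ∀ᶠ s : ℝ in 𝓝 0, |s| ≤ 1 := by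
        filter_upwards [Metric.closedBall_mem_nhds (0 : ℝ) one_pos] with s hs
        simpa using hs
      filter_upwards [this] with s hs
      refine Eventually.of_forall fun x => ?_
      have h1 : |s|⁻¹ * ‖dil s f x - f x - s * dilGen f x‖ ≤ 2 * C / (1 + x ^ 2) := by
        refine (mul_le_mul_of_nonneg_left (key s hs x) (by positivity)).trans ?_
        rw [← mul_assoc]
        refine mul_le_of_le_one_left (by positivity) inv_mul_le_one
      rw [Real.norm_of_nonneg (by positivity)]
      refine (pow_le_pow_left₀ (by positivity) h1 2).trans ?_
      rw [div_pow, div_eq_mul_inv]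
      refine mul_le_mul_of_nonneg_left ?_ (by positivity)
      refine inv_anti₀ (by positivity) ?_
      nlinarith [sq_nonneg x]
    · exact integrable_inv_one_add_sq.const_mul _
    · refine Eventually.of_forall fun x => ?_
      have := hasDerivAt_iff_tendsto.mp (dil_pointwise f x 0)
      have := this.pow 2
      simpa [dil_zero] using this
  simp only [integral_zero] at hlim
  have := (hlim.congr fun s => (hsq s).symm).sqrt
  simp only [Real.sqrt_zero] at this
  refine this.congr fun s => Real.sqrt_sq (by positivity)

theorem dil_hasDerivAt (f : 𝓢(ℝ, ℂ)) (t : ℝ) :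
    HasDerivAt (fun s => (dil s f).toLp 2 volume) ((dil t (dilGen f)).toLp 2 volume) t := by
  have h := hasDerivAt_iso (norm_dil t) (dil_hasDerivAt_zero f)
  have h2 := HasDerivAt.comp_sub_const t t (by simpa using h)
  refine h2.congr_of_eventuallyEq (Eventually.of_forall fun s => ?_)
  simp [dil_add]

theorem dil_gen_comm (f : 𝓢(ℝ, ℂ)) (t : ℝ) : dil t (dilGen f) = dilGen (dil t f) := by
  ext x
  have h : HasDerivAt (fun y => dil t f y) (Real.exp (t / 2) * (Real.exp t • deriv f (Real.exp t * x))) x := by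
    simp only [dil_apply]
    refine HasDerivAt.const_mul _ ?_
    have := HasDerivAt.scomp x (f.hasDerivAt _) ((hasDerivAt_id x).const_mul (Real.exp t))
    simpa [Function.comp_def] using this
  simp only [dilGen, add_apply, smul_apply, ContinuousLinearMap.comp_apply, posOp_apply, dil_apply,
    ContinuousLinearMap.id_apply, SchwartzMap.derivCLM_apply]
  rw [h.deriv]
  simp
  ring

theorem exists_schrodingerSolution {N : ℕ} (hN : 1 ≤ N) {a b c : ℝ} (hyp : a * b < c ^ 2)
    (f : 𝓢(ℝ, ℂ)) : ∃ ψ, IsSchrodingerSolution N a b c ψ ∧ ψ 0 = f := by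
  obtain ⟨k, hk, hm⟩ : ∃ k, b * k ^ 2 + 2 * c * k + a = 0 ∧ c + b * k ≠ 0 := by
    by_cases hb : b = 0
    · subst hb
      have hc : c ≠ 0 := by rintro rfl; simp at hyp
      exact ⟨-a / (2 * c), by field_simp; ring, by simpa using hc⟩
    · have hs : √(c ^ 2 - a * b) ^ 2 = c ^ 2 - a * b := Real.sq_sqrt (by linarith)
      have hpos : 0 < √(c ^ 2 - a * b) := Real.sqrt_pos.2 (by linarith)
      refine ⟨(√(c ^ 2 - a * b) - c) / b, ?_, ?_⟩
      · field_simp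
        rw [mul_comm b a]
        linear_combination hs
      · rw [mul_div_cancel₀ _ hb]
        simpa using hpos.ne'
  set m := c + b * k
  set s := Real.pi * N * k
  set r := Real.pi * b / (2 * N * m)
  have hinv : conjOp s r (chirp (-r) (𝓕 (chirp (-s) f))) = f := by
    simp only [conjOp, ContinuousLinearMap.comp_apply, chirp_neg_apply, invF_apply,
      FourierTransform.fourierInv_fourier_eq]
  set g := chirp (-r) (𝓕 (chirp (-s) f))
  refine ⟨fun t => conjOp s r (dil (m * t) g), fun t => ?_, by simp [dil_zero, hinv]⟩
  have h1 : HasDerivAt (fun t => (dil (m * t) g).toLp 2 volume)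
      (((m : ℂ) • dil (m * t) (dilGen g)).toLp 2 volume) t :=
    HasDerivAt.scomp t (dil_hasDerivAt g (m * t)) (((hasDerivAt_id t).const_mul m).congr_deriv (mul_one m))
  have h2 := hasDerivAt_iso (norm_conjOp_toLp s r) h1
  have h3 := ham_conjOp hN hk hm (dil (m * t) g)
  refine h2.congr_deriv ?_
  rw [dil_gen_comm, ← h3]
  rfl

theorem inner_posOp (f g : 𝓢(ℝ, ℂ)) : inner ℂ (SchwartzMap.toLp (posOp f) 2 (volume : Measure ℝ))
      (SchwartzMap.toLp g 2 (volume : Measure ℝ)) = inner ℂ (SchwartzMap.toLp f 2 (volume : Measure ℝ))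
      (SchwartzMap.toLp (posOp g) 2 (volume : Measure ℝ)) := by
  simp only [SchwartzMap.inner_toL2_toL2_eq]
  congr 1
  ext x
  simp [posOp_apply]
  ring

theorem inner_dOp (f g : 𝓢(ℝ, ℂ)) : inner ℂ (SchwartzMap.toLp f 2 (volume : Measure ℝ))
      (SchwartzMap.toLp (dOp g) 2 (volume : Measure ℝ)) = -inner ℂ (SchwartzMap.toLp (dOp f) 2 (volume : Measure ℝ))
      (SchwartzMap.toLp g 2 (volume : Measure ℝ)) := by
  simp only [SchwartzMap.inner_toL2_toL2_eq]
  have := SchwartzMap.integral_bilinear_deriv_right_eq_neg_left f g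
    ((ContinuousLinearMap.mul ℝ ℂ).comp (Complex.conjCLE : ℂ →L[ℝ] ℂ))
  simpa [mul_comm] using this

theorem conj_two : conj (2 : ℂ) = 2 := map_ofNat _ 2

theorem inner_momOp (N : ℕ) (f g : 𝓢(ℝ, ℂ)) : inner ℂ (SchwartzMap.toLp (momOp N f) 2 (volume : Measure ℝ))
      (SchwartzMap.toLp g 2 (volume : Measure ℝ)) = inner ℂ (SchwartzMap.toLp f 2 (volume : Measure ℝ))
      (SchwartzMap.toLp (momOp N g) 2 (volume : Measure ℝ)) := by
  have h := inner_dOp f g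
  simp only [momOp, smul_apply, toLp_eq, map_smul, inner_smul_left, inner_smul_right] at h ⊢
  rw [h]
  simp [conj_two]

theorem inner_hamOp (N : ℕ) (a b c : ℝ) (f g : 𝓢(ℝ, ℂ)) :
    inner ℂ (SchwartzMap.toLp (hamOp N a b c f) 2 (volume : Measure ℝ))
      (SchwartzMap.toLp g 2 (volume : Measure ℝ)) = inner ℂ (SchwartzMap.toLp f 2 (volume : Measure ℝ))
      (SchwartzMap.toLp (hamOp N a b c g) 2 (volume : Measure ℝ)) := by
  have e1 := fun f g => inner_posOp f g
  have e2 := fun f g => inner_momOp N f g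
  simp only [toLp_eq] at e1 e2 ⊢
  simp only [hamOp, add_apply, smul_apply, ContinuousLinearMap.comp_apply, map_add, map_smul,
    inner_add_left, inner_add_right, inner_smul_left, inner_smul_right, e1, e2]
  simp only [map_div₀, Complex.conj_ofReal, conj_two]
  ring

theorem schrodingerSolution_unique {N : ℕ} {a b c : ℝ} {ψ χ : ℝ → 𝓢(ℝ, ℂ)}
    (hψ : IsSchrodingerSolution N a b c ψ) (hχ : IsSchrodingerSolution N a b c χ)
    (h0 : ψ 0 = χ 0) : ψ = χ := by
  let w : ℝ → 𝓢(ℝ, ℂ) := fun t => ψ t - χ t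
  have hw : ∀ t, HasDerivAt (fun s => (w s).toLp 2 volume)
      ((2 * Real.pi * N / Complex.I : ℂ) • (hamOp N a b c (w t)).toLp 2 volume) t := by
    intro t
    have := (hψ t).sub (hχ t)
    simp only [w, toLp_eq, map_sub, smul_sub] at this ⊢
    exact this
  have hd : ∀ t, HasDerivAt (fun s => inner ℂ (SchwartzMap.toLp (w s) 2 (volume : Measure ℝ))
      (SchwartzMap.toLp (w s) 2 (volume : Measure ℝ))) 0 t := by
    intro t
    refine ((hw t).inner ℂ (hw t)).congr_deriv ?_
    rw [inner_smul_left, inner_smul_right, inner_hamOp]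
    simp [conj_two]
  funext t
  have hc := is_const_of_deriv_eq_zero (fun t => (hd t).differentiableAt) (fun t => (hd t).deriv) t 0
  have hw0 : w 0 = 0 := by simp [w, h0]
  rw [hw0] at hc
  have hz : ((0 : 𝓢(ℝ, ℂ)).toLp 2 volume) = 0 := map_zero (SchwartzMap.toLpCLM ℂ ℂ 2 volume)
  rw [hz, inner_zero_left, inner_self_eq_zero, ← hz] at hc
  exact sub_eq_zero.mp (SchwartzMap.injective_toLp 2 volume hc)

/-! ### The quantum cat map -/

/-- The Schrödinger flow at time one, `e^{-2πi Ĥ / h}` with `h = 1 / N`, on Schwartz functions: it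
sends `f` to `ψ(1)`, where `ψ` is the solution of the Schrödinger equation with `ψ(0) = f`. For
`N ≥ 1` and `a b < c²` the solution exists and is unique (see `exists_schrodingerSolution` and
`schrodingerSolution_unique`); the value `0` in the other case is a placeholder. -/
def propagator (N : ℕ) (a b c : ℝ) (f : 𝓢(ℝ, ℂ)) : 𝓢(ℝ, ℂ) :=
  open Classical in
  if h : ∃ ψ, IsSchrodingerSolution N a b c ψ ∧ ψ 0 = f then h.choose 1 else 0

theorem propagator_eq {N : ℕ} {a b c : ℝ} {ψ : ℝ → 𝓢(ℝ, ℂ)}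
    (hψ : IsSchrodingerSolution N a b c ψ) : propagator N a b c (ψ 0) = ψ 1 := by
  have h : ∃ χ, IsSchrodingerSolution N a b c χ ∧ χ 0 = ψ 0 := ⟨ψ, hψ, rfl⟩
  rw [propagator, dif_pos h]
  rw [schrodingerSolution_unique h.choose_spec.1 hψ h.choose_spec.2]

/-- `M = ± exp X`, where `X` generates the classical flow `q' = b p + c q`, `p' = -a q - c p` of the
hyperbolic quadratic Hamiltonian `H(q, p) = a q² / 2 + b p² / 2 + c q p`. The sign `ε` is that of
the trace of `M`. -/
structure IsGenerator (M : Matrix.SpecialLinearGroup (Fin 2) ℤ) (ε : ℤˣ) (a b c : ℝ) : Prop where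
  hyperbolic : a * b < c ^ 2
  eq_exp : (M : Matrix (Fin 2) (Fin 2) ℤ).map (Int.cast : ℤ → ℝ) =
    ((ε : ℤ) : ℝ) • NormedSpace.exp (!![c, b; -a, -c] : Matrix (Fin 2) (Fin 2) ℝ)

/-- The quantization on Schwartz functions of `ε exp X`: the Schrödinger flow at time one, followed
for `ε = -1` by the quantization `f(q) ↦ f(-q)` of minus the identity. -/
def quantization (N : ℕ) (ε : ℤˣ) (a b c : ℝ) (f : 𝓢(ℝ, ℂ)) : 𝓢(ℝ, ℂ) :=
  if ε = 1 then propagator N a b c f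
  else SchwartzMap.compCLMOfContinuousLinearEquiv ℂ (ContinuousLinearEquiv.neg ℝ)
    (propagator N a b c f)

/-! ### Quantum states on the torus -/

/-- The space `H_{N,κ}` of quantum states. The sequence `Ψ` stands for the distribution
`∑ₖ Ψ(k) δ(q - (k + κ₁) / N)`, with `Ψ(k + N) = exp(-2πi κ₂) Ψ(k)`. -/
def torusStates (N : ℕ) (κ : ℝ × ℝ) : Submodule ℂ (ℤ → ℂ) where
  carrier := {Ψ | ∀ k, Ψ (k + N) = Complex.exp (-(2 * Real.pi * Complex.I * κ.2)) * Ψ k}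
  add_mem' h₁ h₂ k := by simp [h₁ k, h₂ k, mul_add]
  zero_mem' k := by simp
  smul_mem' z Ψ h k := by
    simp only [Set.mem_ofPred_eq] at h
    simp only [Pi.smul_apply, h k, smul_eq_mul]
    ring

/-- The inner product `⟨Ψ, Φ⟩ = N⁻¹ ∑_{1 ≤ k ≤ N} Ψ(k) conj(Φ(k))` of `H_{N,κ}`. -/
def stateInner (N : ℕ) (Ψ Φ : ℤ → ℂ) : ℂ :=
  (1 / N : ℂ) * ∑ k ∈ Finset.Icc 1 N, Ψ k * conj (Φ k)

/-- The value at `conj f` of the distribution `∑ₖ Ψ(k) δ(q - (k + κ₁) / N)`, that is, its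
(sesquilinear) pairing `⟨ψ, f⟩` with the Schwartz function `f`. -/
def pairing (N : ℕ) (κ : ℝ × ℝ) (Ψ : ℤ → ℂ) (f : 𝓢(ℝ, ℂ)) : ℂ :=
  ∑' k : ℤ, Ψ k * conj (f ((k + κ.1) / N))

/-- `Φ = M̂ Ψ` as distributions. The unitary operator `M̂`, a bijection of the Schwartz space, acts on
distributions by duality: `⟨M̂ ψ, M̂ f⟩ = ⟨ψ, f⟩` for all Schwartz functions `f`. -/
def IsImage (N : ℕ) (ε : ℤˣ) (a b c : ℝ) (κ : ℝ × ℝ) (Ψ Φ : ℤ → ℂ) : Prop :=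
  ∀ f : 𝓢(ℝ, ℂ), pairing N κ Φ (quantization N ε a b c f) = pairing N κ Ψ f

/-- `M̂` maps `H_{N,κ}` to itself. -/
def PreservesStates (N : ℕ) (ε : ℤˣ) (a b c : ℝ) (κ : ℝ × ℝ) : Prop :=
  ∀ Ψ ∈ torusStates N κ, ∃ Φ ∈ torusStates N κ, IsImage N ε a b c κ Ψ Φ

/-- `φ` is an orthonormal basis of the `N`-dimensional space `H_{N,κ}` that consists of
eigenstates of the quantum cat map `M̂`. -/
structure IsEigenbasis (N : ℕ) (ε : ℤˣ) (a b c : ℝ) (κ : ℝ × ℝ) (φ : Fin N → ℤ → ℂ) : Prop where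
  mem : ∀ j, φ j ∈ torusStates N κ
  orthonormal : ∀ i j, stateInner N (φ i) (φ j) = if i = j then 1 else 0
  eigen : ∀ j, ∃ θ : ℝ, IsImage N ε a b c κ (φ j) (Complex.exp (Complex.I * θ) • φ j)

/-- The position density `|ψ|² dVol` of a state, as a measure on `T¹ = ℝ / ℤ`: mass `|Ψ(k)|² / N` at
the point `(k + κ₁) / N`, for `1 ≤ k ≤ N`. A normalized state has total mass one. -/
def positionMeasure (N : ℕ) (κ : ℝ × ℝ) (Ψ : ℤ → ℂ) : Measure UnitAddCircle :=
  ∑ k ∈ Finset.Icc 1 N, ENNReal.ofReal (‖Ψ k‖ ^ 2 / N) •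
    Measure.dirac ((((k : ℝ) + κ.1) / N : ℝ) : UnitAddCircle)

end QuantumCat

end

/-!
The Fourier coefficients of the position density of an eigenstate are the expectation values of the
Weyl operators `W (0, n)`. By the exact Egorov property, conjugation by `M̂` maps `W v` to
`W (M v)`, which has the same expectation value in an eigenstate, so `W (0, n)` may be replaced by
its average over a number of points of the orbit of `(0, n)` proportional to `log N`. For `n ≤ √N`
the first coordinates of these points are distinct modulo `N`, hence the operators are orthogonal in
the Hilbert-Schmidt inner product and the mean square of the coefficient over an eigenbasis is
`O(1 / log N)`.

Squeezing the indicator of a ball of radius `r` between trapezoids, whose `n`-th coefficients are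
`O(min(r, 1 / (r n²)))` with sum `O(1)`, bounds the deviation on all balls of radius `r` at once by
a sum of Fourier coefficients of mean `O((log N) ^ (-1 / 2))`. When this is `o(r)`, Markov's
inequality leaves out only a vanishing proportion of the eigenstates.
-/

noncomputable section

namespace QuantumCat

open Complex (I)
open scoped Real

/-! ### Weyl operators and the exact Egorov property -/

theorem hasTemperateGrowth_cexp_I_mul_ofReal :
    (fun x : ℝ => Complex.exp (I * x)).HasTemperateGrowth := by
  have hder (x : ℝ) :
      HasDerivAt (fun x : ℝ => Complex.exp (I * x)) (I * Complex.exp (I * x)) x := by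
    simpa [mul_comm] using ((Complex.ofRealCLM.hasDerivAt (x := x)).const_mul I).cexp
  have hiter (n : ℕ) : iteratedDeriv n (fun x : ℝ => Complex.exp (I * x)) =
      fun x : ℝ => I ^ n * Complex.exp (I * x) := by
    induction n with
    | zero => simp
    | succ n ih =>
      ext x
      rw [iteratedDeriv_succ, ih, ((hder x).const_mul _).deriv]
      ring
  refine ⟨(contDiff_const.mul Complex.ofRealCLM.contDiff).cexp, fun n => ⟨0, 1, fun x => ?_⟩⟩
  rw [norm_iteratedFDeriv_eq_norm_iteratedDeriv, hiter]
  simp [mul_comm I, Complex.norm_exp_ofReal_mul_I]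

theorem hasTemperateGrowth_cexp_I_mul {g : ℝ → ℝ} (hg : g.HasTemperateGrowth) :
    (fun q : ℝ => Complex.exp (I * g q)).HasTemperateGrowth :=
  hasTemperateGrowth_cexp_I_mul_ofReal.comp hg

/-- The Weyl operator of the phase space translation by `v = (x, ξ)`, with Planck constant `1 / N`:
`f(q) ↦ exp(πi N ξ (2 q - x)) f(q - x)`. -/
def weyl (N : ℕ) (v : Fin 2 → ℝ) : 𝓢(ℝ, ℂ) →L[ℂ] 𝓢(ℝ, ℂ) :=
  (SchwartzMap.smulLeftCLM ℂ fun q : ℝ =>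
    Complex.exp (I * (π * N * v 1 * (2 * q - v 0) : ℝ))).comp
    (SchwartzMap.compSubConstCLM ℂ (v 0))

theorem weyl_apply (N : ℕ) (v : Fin 2 → ℝ) (f : 𝓢(ℝ, ℂ)) (q : ℝ) :
    weyl N v f q = Complex.exp (I * (π * N * v 1 * (2 * q - v 0) : ℝ)) * f (q - v 0) := by
  have hphase : (fun q : ℝ => π * N * v 1 * (2 * q - v 0)).HasTemperateGrowth := by fun_prop
  rw [weyl, ContinuousLinearMap.comp_apply,
    SchwartzMap.smulLeftCLM_apply_apply (hasTemperateGrowth_cexp_I_mul hphase)]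
  simp

/-- The exact Egorov property: conjugation by `Q` moves the Weyl operators by the linear map `A` of
phase space, so that `Q` quantizes `A`. -/
def Intertwines (N : ℕ) (Q : 𝓢(ℝ, ℂ) → 𝓢(ℝ, ℂ)) (A : Matrix (Fin 2) (Fin 2) ℝ) : Prop :=
  ∀ v f, Q (weyl N v f) = weyl N (A.mulVec v) (Q f)

theorem Intertwines.comp {N : ℕ} {Q R : 𝓢(ℝ, ℂ) → 𝓢(ℝ, ℂ)} {A B : Matrix (Fin 2) (Fin 2) ℝ}
    (hQ : Intertwines N Q A) (hR : Intertwines N R B) : Intertwines N (Q ∘ R) (A * B) := by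
  intro v f
  rw [Function.comp_apply, hR, hQ, Matrix.mulVec_mulVec, Function.comp_apply]

theorem Intertwines.symm {N : ℕ} {Q : 𝓢(ℝ, ℂ) ≃ 𝓢(ℝ, ℂ)} {A B : Matrix (Fin 2) (Fin 2) ℝ}
    (hQ : Intertwines N Q A) (hAB : A * B = 1) : Intertwines N Q.symm B := by
  intro v f
  rw [Q.symm_apply_eq, hQ, Matrix.mulVec_mulVec, hAB, Matrix.one_mulVec, Q.apply_symm_apply]

theorem intertwines_chirp {N : ℕ} (hN : 1 ≤ N) (s : ℝ) :
    Intertwines N (chirp s) !![1, 0; s / (π * N), 1] := by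
  intro v f
  ext q
  have hN' : (N : ℝ) ≠ 0 := by positivity
  simp only [chirp_apply, weyl_apply, chirpFun, Matrix.cons_mulVec, Matrix.cons_dotProduct,
    Matrix.dotProduct_of_isEmpty, Matrix.cons_val_zero, Matrix.cons_val_one,
    Matrix.vecHead, Matrix.vecTail, Function.comp_apply, Fin.succ_zero_eq_one, one_mul, zero_mul,
    add_zero]
  rw [← mul_assoc, ← mul_assoc, ← Complex.exp_add, ← Complex.exp_add, ← mul_add, ← mul_add,
    ← Complex.ofReal_add, ← Complex.ofReal_add]
  congr 4
  field_simp
  ring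

theorem intertwines_invF {N : ℕ} (hN : 1 ≤ N) :
    Intertwines N invF !![0, -(N : ℝ); 1 / N, 0] := by
  intro v f
  have hN' : (N : ℂ) ≠ 0 := by exact_mod_cast Nat.one_le_iff_ne_zero.1 hN
  ext q
  simp only [weyl_apply, Matrix.mulVec, dotProduct, Fin.sum_univ_two, Matrix.of_apply,
    Matrix.cons_val', Matrix.cons_val_zero, Matrix.cons_val_one, Matrix.cons_val_fin_one,
    invF_apply, SchwartzMap.fourierInv_coe, Real.fourierInv_eq', zero_mul, zero_add, add_zero]
  rw [← integral_const_mul, ← integral_add_right_eq_self _ (v 0)]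
  congr 1
  ext y
  simp only [add_sub_cancel_right, smul_eq_mul, inner, ← mul_assoc]
  rw [← Complex.exp_add, ← Complex.exp_add]
  congr 2
  push_cast
  simp only [star_trivial, RCLike.mul_re, RCLike.re_to_real, RCLike.im_to_real, mul_zero, sub_zero,
    Complex.ofReal_mul, Complex.ofReal_add, one_div, neg_mul, sub_neg_eq_add,
    Complex.ofReal_natCast]
  field_simp
  ring

theorem intertwines_dil (N : ℕ) (t : ℝ) :
    Intertwines N (dil t) (Matrix.diagonal ![Real.exp (-t), Real.exp t]) := by
  intro v f
  ext q
  have hinv : Real.exp t * Real.exp (-t) = 1 := by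
    rw [← Real.exp_add, add_neg_cancel, Real.exp_zero]
  have hshift : Real.exp t * (q - Real.exp (-t) * v 0) = Real.exp t * q - v 0 := by
    linear_combination -(v 0) * hinv
  have hphase : π * N * (Real.exp t * v 1) * (2 * q - Real.exp (-t) * v 0) =
      π * N * v 1 * (2 * (Real.exp t * q) - v 0) := by
    linear_combination -(π * N * v 0 * v 1) * hinv
  simp only [dil_apply, weyl_apply, Matrix.mulVec_diagonal, Matrix.cons_val_zero,
    Matrix.cons_val_one, hshift, hphase]
  ring

theorem intertwines_reflection (N : ℕ) :
    Intertwines N (SchwartzMap.compCLMOfContinuousLinearEquiv ℂ (ContinuousLinearEquiv.neg ℝ))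
      (-1) := by
  intro v f
  ext q
  simp only [SchwartzMap.compCLMOfContinuousLinearEquiv_apply, Function.comp_apply, weyl_apply,
    ContinuousLinearEquiv.coe_neg, Matrix.neg_mulVec, Matrix.one_mulVec, Pi.neg_apply, id]
  congr 4 <;> ring

/-- The operator `conjOp s r` as a bijection of the Schwartz space. -/
def conjEquiv (s r : ℝ) : 𝓢(ℝ, ℂ) ≃ 𝓢(ℝ, ℂ) where
  toFun := conjOp s r
  invFun f := chirp (-r) (𝓕 (chirp (-s) f))
  left_inv f := by
    have hchirp (t : ℝ) (g : 𝓢(ℝ, ℂ)) : chirp (-t) (chirp t g) = g := by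
      simpa using chirp_neg_apply (-t) g
    simp only [conjOp, ContinuousLinearMap.comp_apply, hchirp, invF_apply,
      FourierTransform.fourier_fourierInv_eq]
  right_inv f := by
    simp only [conjOp, ContinuousLinearMap.comp_apply, chirp_neg_apply, invF_apply,
      FourierTransform.fourierInv_fourier_eq]

/-- The symplectic matrix quantized by `conjOp s r`: the product of a shear, a scaled quarter turn
and a shear. -/
def conjMatrix (N : ℕ) (s r : ℝ) : Matrix (Fin 2) (Fin 2) ℝ :=
  !![-(r / π), -N; 1 / N - s * r / (π ^ 2 * N), -(s / π)]

theorem conjMatrix_eq_mul {N : ℕ} (hN : 1 ≤ N) (s r : ℝ) :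
    conjMatrix N s r = !![1, 0; s / (π * N), 1] *
      (!![0, -(N : ℝ); 1 / N, 0] * !![1, 0; r / (π * N), 1]) := by
  have hN' : (N : ℝ) ≠ 0 := by positivity
  ext i j
  fin_cases i <;> fin_cases j <;> simp [conjMatrix] <;> field_simp
  ring

theorem det_conjMatrix {N : ℕ} (hN : 1 ≤ N) (s r : ℝ) : (conjMatrix N s r).det = 1 := by
  have hN' : (N : ℝ) ≠ 0 := by positivity
  rw [conjMatrix, Matrix.det_fin_two_of]
  field_simp
  ring

theorem intertwines_conjEquiv {N : ℕ} (hN : 1 ≤ N) (s r : ℝ) :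
    Intertwines N (conjEquiv s r) (conjMatrix N s r) :=
  conjMatrix_eq_mul hN s r ▸
    (intertwines_chirp hN s).comp ((intertwines_invF hN).comp (intertwines_chirp hN r))

-- The line `p = k q` is invariant under the classical flow, which expands it at rate `c + b k`.
theorem exists_slope {a b c : ℝ} (hyp : a * b < c ^ 2) :
    ∃ k, b * k ^ 2 + 2 * c * k + a = 0 ∧ c + b * k ≠ 0 := by
  obtain rfl | hb := eq_or_ne b 0
  · have hc : c ≠ 0 := by rintro rfl; simp at hyp
    exact ⟨-a / (2 * c), by field_simp; ring, by simpa using hc⟩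
  · have hsq : √(c ^ 2 - a * b) ^ 2 = c ^ 2 - a * b := Real.sq_sqrt (by linarith)
    have hpos : 0 < √(c ^ 2 - a * b) := Real.sqrt_pos.2 (by linarith)
    refine ⟨(√(c ^ 2 - a * b) - c) / b, ?_, ?_⟩
    · field_simp
      rw [mul_comm b a]
      linear_combination hsq
    · rw [mul_div_cancel₀ _ hb]
      simpa using hpos.ne'

section Slope

variable {N : ℕ} {a b c k : ℝ}

theorem isSchrodingerSolution_conjOp_dil (hN : 1 ≤ N) (hk : b * k ^ 2 + 2 * c * k + a = 0)
    (hm : c + b * k ≠ 0) (g : 𝓢(ℝ, ℂ)) :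
    IsSchrodingerSolution N a b c fun t =>
      conjOp (π * N * k) (π * b / (2 * N * (c + b * k))) (dil ((c + b * k) * t) g) := by
  intro t
  set m := c + b * k
  have hdil : HasDerivAt (fun t => (dil (m * t) g).toLp 2 volume)
      (((m : ℂ) • dil (m * t) (dilGen g)).toLp 2 volume) t :=
    HasDerivAt.scomp t (dil_hasDerivAt g (m * t))
      (((hasDerivAt_id t).const_mul m).congr_deriv (mul_one m))
  refine (hasDerivAt_iso (norm_conjOp_toLp _ _) hdil).congr_deriv ?_
  rw [dil_gen_comm, ← ham_conjOp hN hk hm (dil (m * t) g)]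
  rfl

theorem propagator_eq_conj (hN : 1 ≤ N) (hk : b * k ^ 2 + 2 * c * k + a = 0)
    (hm : c + b * k ≠ 0) :
    propagator N a b c = conjEquiv (π * N * k) (π * b / (2 * N * (c + b * k))) ∘
      dil (c + b * k) ∘ (conjEquiv (π * N * k) (π * b / (2 * N * (c + b * k)))).symm := by
  ext1 f
  set Q := conjEquiv (π * N * k) (π * b / (2 * N * (c + b * k)))
  have h := propagator_eq (isSchrodingerSolution_conjOp_dil hN hk hm (Q.symm f))
  rw [mul_zero, mul_one, dil_zero] at h
  exact (congrArg _ (Q.apply_symm_apply f).symm).trans h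

theorem generator_mul_conjMatrix (hN : 1 ≤ N) (hk : b * k ^ 2 + 2 * c * k + a = 0)
    (hm : c + b * k ≠ 0) :
    !![c, b; -a, -c] * conjMatrix N (π * N * k) (π * b / (2 * N * (c + b * k))) =
      conjMatrix N (π * N * k) (π * b / (2 * N * (c + b * k))) *
        Matrix.diagonal ![-(c + b * k), c + b * k] := by
  have hN' : (N : ℝ) ≠ 0 := by positivity
  obtain rfl : a = -(b * k ^ 2 + 2 * c * k) := by linarith
  ext i j
  fin_cases i <;> fin_cases j <;> simp [conjMatrix] <;> field_simp <;> ring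

end Slope

theorem exp_of_mul_eq_mul_diagonal {X P : Matrix (Fin 2) (Fin 2) ℝ} (hP : IsUnit P) {x y : ℝ}
    (h : X * P = P * Matrix.diagonal ![x, y]) :
    NormedSpace.exp X = P * (Matrix.diagonal ![Real.exp x, Real.exp y] * P⁻¹) := by
  have hPinv : P * P⁻¹ = 1 := Matrix.mul_nonsing_inv P ((Matrix.isUnit_iff_isUnit_det P).1 hP)
  have hX : X = P * Matrix.diagonal ![x, y] * P⁻¹ := by rw [← h, mul_assoc, hPinv, mul_one]
  have hexp : NormedSpace.exp ![x, y] = ![Real.exp x, Real.exp y] := by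
    ext i
    fin_cases i <;> simp [Real.exp_eq_exp_ℝ, NormedSpace.exp]
  rw [hX, Matrix.exp_conj _ _ hP, Matrix.exp_diagonal, hexp, mul_assoc]

theorem intertwines_propagator {N : ℕ} (hN : 1 ≤ N) {a b c : ℝ} (hyp : a * b < c ^ 2) :
    Intertwines N (propagator N a b c)
      (NormedSpace.exp (!![c, b; -a, -c] : Matrix (Fin 2) (Fin 2) ℝ)) := by
  obtain ⟨k, hk, hm⟩ := exists_slope hyp
  have hdet : IsUnit (conjMatrix N (π * N * k) (π * b / (2 * N * (c + b * k)))).det :=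
    det_conjMatrix hN _ _ ▸ isUnit_one
  have hconj := intertwines_conjEquiv hN (π * N * k) (π * b / (2 * N * (c + b * k)))
  rw [propagator_eq_conj hN hk hm, exp_of_mul_eq_mul_diagonal
    ((Matrix.isUnit_iff_isUnit_det _).2 hdet) (generator_mul_conjMatrix hN hk hm)]
  exact hconj.comp ((intertwines_dil N _).comp (hconj.symm (Matrix.mul_nonsing_inv _ hdet)))

theorem propagator_surjective {N : ℕ} (hN : 1 ≤ N) {a b c : ℝ} (hyp : a * b < c ^ 2) :
    Function.Surjective (propagator N a b c) := by
  obtain ⟨k, hk, hm⟩ := exists_slope hyp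
  have hdil (t : ℝ) : Function.Surjective (dil t) := fun f =>
    ⟨dil (-t) f, by rw [dil_add, add_neg_cancel, dil_zero]⟩
  rw [propagator_eq_conj hN hk hm]
  exact (Equiv.surjective _).comp ((hdil _).comp (Equiv.surjective _))

theorem intertwines_quantization {N : ℕ} (hN : 1 ≤ N)
    {M : Matrix.SpecialLinearGroup (Fin 2) ℤ} {ε : ℤˣ} {a b c : ℝ} (hgen : IsGenerator M ε a b c) :
    Intertwines N (quantization N ε a b c)
      ((M : Matrix (Fin 2) (Fin 2) ℤ).map (Int.cast : ℤ → ℝ)) := by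
  have hprop := intertwines_propagator hN hgen.hyperbolic
  intro v f
  rw [hgen.eq_exp]
  rcases Int.units_eq_one_or ε with rfl | rfl
  · simpa [quantization] using hprop v f
  · have hne : (-1 : ℤˣ) ≠ 1 := by decide
    simpa [quantization, hne] using (intertwines_reflection N).comp hprop v f

theorem quantization_surjective {N : ℕ} (hN : 1 ≤ N) (ε : ℤˣ) {a b c : ℝ} (hyp : a * b < c ^ 2) :
    Function.Surjective (quantization N ε a b c) := by
  intro g
  by_cases hε : ε = 1
  · obtain ⟨f, hf⟩ := propagator_surjective hN hyp g
    exact ⟨f, by simp [quantization, hε, hf]⟩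
  · obtain ⟨f, hf⟩ := propagator_surjective hN hyp
      (SchwartzMap.compCLMOfContinuousLinearEquiv ℂ (ContinuousLinearEquiv.neg ℝ) g)
    refine ⟨f, ?_⟩
    ext q
    simp [quantization, hε, hf]

/-! ### Torus states -/

theorem torusStates_add_int_mul {N : ℕ} {κ : ℝ × ℝ} {Ψ : ℤ → ℂ} (hΨ : Ψ ∈ torusStates N κ)
    (k z : ℤ) : Ψ (k + z * N) = Complex.exp (-(2 * π * I * κ.2)) ^ z * Ψ k := by
  have hstep (k : ℤ) : Ψ (k + N) = Complex.exp (-(2 * π * I * κ.2)) * Ψ k := hΨ k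
  have hne := Complex.exp_ne_zero (-(2 * π * I * κ.2))
  induction z using Int.induction_on with
  | zero => simp
  | succ n ih =>
    rw [add_mul, one_mul, ← add_assoc, hstep, ih, zpow_add₀ hne, zpow_one]
    ring
  | pred n ih =>
    have h := hstep (k + (-(n : ℤ) - 1) * N)
    rw [show k + (-(n : ℤ) - 1) * N + N = k + -(n : ℤ) * N by ring, ih] at h
    rw [zpow_sub₀ hne, zpow_one, div_mul_eq_mul_div, h, mul_div_cancel_left₀ _ hne]

theorem norm_torusStates_add_int_mul {N : ℕ} {κ : ℝ × ℝ} {Ψ : ℤ → ℂ} (hΨ : Ψ ∈ torusStates N κ)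
    (k z : ℤ) : ‖Ψ (k + z * N)‖ = ‖Ψ k‖ := by
  rw [torusStates_add_int_mul hΨ, norm_mul, norm_zpow, Complex.norm_exp]
  simp

theorem exists_eq_natCast_add_int_mul {N : ℕ} (hN : 1 ≤ N) (k : ℤ) :
    ∃ l ∈ Finset.Icc 1 N, ∃ z : ℤ, k = (l : ℤ) + z * N := by
  obtain ⟨m, hm, -⟩ := existsUnique_add_zsmul_mem_Ioc (a := (N : ℤ)) (by exact_mod_cast hN) k 0
  rw [smul_eq_mul, zero_add, Set.mem_Ioc] at hm
  exact ⟨(k + m * N).toNat, by rw [Finset.mem_Icc]; lia, -m, by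
    rw [Int.toNat_of_nonneg hm.1.le]; ring⟩

theorem torusStates_ext {N : ℕ} (hN : 1 ≤ N) {κ : ℝ × ℝ} {Ψ Φ : ℤ → ℂ} (hΨ : Ψ ∈ torusStates N κ)
    (hΦ : Φ ∈ torusStates N κ) (h : ∀ l ∈ Finset.Icc 1 N, Ψ (l : ℤ) = Φ (l : ℤ)) : Ψ = Φ := by
  funext k
  obtain ⟨l, hl, z, rfl⟩ := exists_eq_natCast_add_int_mul hN k
  rw [torusStates_add_int_mul hΨ, torusStates_add_int_mul hΦ, h l hl]

theorem exists_norm_torusStates_le {N : ℕ} (hN : 1 ≤ N) {κ : ℝ × ℝ} {Ψ : ℤ → ℂ}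
    (hΨ : Ψ ∈ torusStates N κ) : ∃ C, ∀ k, ‖Ψ k‖ ≤ C := by
  refine ⟨∑ l ∈ Finset.Icc 1 N, ‖Ψ (l : ℤ)‖, fun k => ?_⟩
  obtain ⟨l, hl, z, rfl⟩ := exists_eq_natCast_add_int_mul hN k
  rw [norm_torusStates_add_int_mul hΨ]
  exact Finset.single_le_sum (f := fun l : ℕ => ‖Ψ (l : ℤ)‖) (fun _ _ => norm_nonneg _) hl

/-! ### The pairing with Schwartz functions -/

theorem summable_norm_schwartz_lattice (f : 𝓢(ℝ, ℂ)) {N : ℕ} (hN : 1 ≤ N) (x : ℝ) :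
    Summable fun k : ℤ => ‖f ((k + x) / N)‖ := by
  have hN' : (N : ℝ) ≠ 0 := by positivity
  obtain ⟨C, hC, hf⟩ := decay_bound f
  refine (((Real.summable_one_div_int_add_rpow x 2).2 one_lt_two).mul_left
    (C * N ^ 2)).of_norm_bounded_eventually ?_
  have hfin : {k : ℤ | (k : ℝ) = -x}.Finite :=
    Set.Subsingleton.finite fun k hk l hl => Int.cast_injective (Eq.trans hk (Eq.symm hl))
  filter_upwards [hfin.compl_mem_cofinite] with k hk
  have hkx : (k : ℝ) + x ≠ 0 := fun h => hk (eq_neg_of_add_eq_zero_left h)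
  rw [norm_norm, Real.rpow_two, sq_abs]
  calc ‖f ((k + x) / N)‖ ≤ C / (1 + ((k + x) / N) ^ 2) := hf _
    _ ≤ C / ((k + x) / N) ^ 2 := by gcongr; linarith
    _ = C * N ^ 2 * (1 / (k + x) ^ 2) := by field_simp

theorem summable_pairing {N : ℕ} (hN : 1 ≤ N) {κ : ℝ × ℝ} {Ψ : ℤ → ℂ} (hΨ : Ψ ∈ torusStates N κ)
    (f : 𝓢(ℝ, ℂ)) : Summable fun k : ℤ => Ψ k * conj (f ((k + κ.1) / N)) := by
  obtain ⟨C, hC⟩ := exists_norm_torusStates_le hN hΨ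
  refine ((summable_norm_schwartz_lattice f hN κ.1).mul_left C).of_norm_bounded fun k => ?_
  rw [norm_mul, RCLike.norm_conj]
  gcongr
  exact hC k

theorem pairing_smul (N : ℕ) (κ : ℝ × ℝ) (z : ℂ) (Ψ : ℤ → ℂ) (f : 𝓢(ℝ, ℂ)) :
    pairing N κ (z • Ψ) f = z * pairing N κ Ψ f := by
  simp only [pairing, Pi.smul_apply, smul_eq_mul, mul_assoc, tsum_mul_left]

theorem pairing_sum {N : ℕ} (hN : 1 ≤ N) {κ : ℝ × ℝ} {ι : Type*} (s : Finset ι)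
    {Ψ : ι → ℤ → ℂ} (hΨ : ∀ j ∈ s, Ψ j ∈ torusStates N κ) (f : 𝓢(ℝ, ℂ)) :
    pairing N κ (∑ j ∈ s, Ψ j) f = ∑ j ∈ s, pairing N κ (Ψ j) f := by
  simp only [pairing, Finset.sum_apply, Finset.sum_mul]
  exact Summable.tsum_finsetSum fun j hj => summable_pairing hN (hΨ j hj) f

theorem exists_pairing_eq_apply {N : ℕ} (hN : 1 ≤ N) (κ : ℝ × ℝ) (k : ℤ) :
    ∃ f, ∀ Ψ, pairing N κ Ψ f = Ψ k := by
  have hN0 : (0 : ℝ) < N := by positivity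
  obtain ⟨g, hg, hgc, hgs, -, hg1⟩ := exists_contDiff_tsupport_subset (n := ⊤)
    (Metric.ball_mem_nhds ((k + κ.1) / N : ℝ) (one_div_pos.2 hN0))
  have hc : HasCompactSupport fun x => (g x : ℂ) := hgc.comp_left Complex.ofReal_zero
  have hg0 (l : ℤ) (hl : l ≠ k) : g ((l + κ.1) / N) = 0 := by
    by_contra hne
    have hdist := hg (subset_tsupport _ (Function.mem_support.2 hne))
    rw [Metric.mem_ball, Real.dist_eq, ← sub_div, abs_div, abs_of_pos hN0,
      div_lt_div_iff_of_pos_right hN0, add_sub_add_right_eq_sub] at hdist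
    exact hl (sub_eq_zero.1 (Int.abs_lt_one_iff.1 (by exact_mod_cast hdist)))
  have hs : ContDiff ℝ ((⊤ : ℕ∞) : WithTop ℕ∞) fun x => (g x : ℂ) :=
    Complex.ofRealCLM.contDiff.comp hgs
  refine ⟨hc.toSchwartzMap hs, fun Ψ => ?_⟩
  rw [pairing, tsum_eq_single k fun l hl => by simp [hg0 l hl]]
  simp [hg1]

theorem eq_of_pairing_eq {N : ℕ} (hN : 1 ≤ N) {κ : ℝ × ℝ} {Ψ Φ : ℤ → ℂ}
    (h : ∀ f, pairing N κ Ψ f = pairing N κ Φ f) : Ψ = Φ := by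
  funext k
  obtain ⟨f, hf⟩ := exists_pairing_eq_apply hN κ k
  rw [← hf Ψ, ← hf Φ, h]

theorem IsImage.smul {N : ℕ} {ε : ℤˣ} {a b c : ℝ} {κ : ℝ × ℝ} {Ψ Φ : ℤ → ℂ}
    (h : IsImage N ε a b c κ Ψ Φ) (z : ℂ) : IsImage N ε a b c κ (z • Ψ) (z • Φ) := fun f => by
  rw [pairing_smul, pairing_smul, h f]

theorem IsImage.sum {N : ℕ} (hN : 1 ≤ N) {ε : ℤˣ} {a b c : ℝ} {κ : ℝ × ℝ} {ι : Type*}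
    {s : Finset ι} {Ψ Φ : ι → ℤ → ℂ} (hΨ : ∀ j ∈ s, Ψ j ∈ torusStates N κ)
    (hΦ : ∀ j ∈ s, Φ j ∈ torusStates N κ) (h : ∀ j ∈ s, IsImage N ε a b c κ (Ψ j) (Φ j)) :
    IsImage N ε a b c κ (∑ j ∈ s, Ψ j) (∑ j ∈ s, Φ j) := fun f => by
  rw [pairing_sum hN s hΨ, pairing_sum hN s hΦ]
  exact Finset.sum_congr rfl fun j hj => h j hj f

theorem IsImage.unique {N : ℕ} (hN : 1 ≤ N) {ε : ℤˣ} {a b c : ℝ} (hyp : a * b < c ^ 2)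
    {κ : ℝ × ℝ} {Ψ Φ Φ' : ℤ → ℂ} (h : IsImage N ε a b c κ Ψ Φ)
    (h' : IsImage N ε a b c κ Ψ Φ') : Φ = Φ' := by
  refine eq_of_pairing_eq (κ := κ) hN fun g => ?_
  obtain ⟨f, rfl⟩ := quantization_surjective hN ε hyp g
  rw [h f, h' f]

/-! ### Weyl translates of torus states -/

/-- The action on states of the adjoint of the Weyl operator of the translation by `w / N`. -/
def shiftOp (N : ℕ) (κ : ℝ × ℝ) (w : Fin 2 → ℤ) : (ℤ → ℂ) →ₗ[ℂ] ℤ → ℂ where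
  toFun Ψ k := Complex.exp (-(2 * π * I * w 1 * (k + κ.1) / N + π * I * w 0 * w 1 / N)) *
    Ψ (k + w 0)
  map_add' Ψ Φ := by ext k; simp only [Pi.add_apply, mul_add]
  map_smul' z Ψ := by ext k; simp only [Pi.smul_apply, smul_eq_mul, mul_left_comm, RingHom.id_apply]

theorem shiftOp_apply (N : ℕ) (κ : ℝ × ℝ) (w : Fin 2 → ℤ) (Ψ : ℤ → ℂ) (k : ℤ) :
    shiftOp N κ w Ψ k =
      Complex.exp (-(2 * π * I * w 1 * (k + κ.1) / N + π * I * w 0 * w 1 / N)) * Ψ (k + w 0) :=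
  rfl

theorem shiftOp_mem {N : ℕ} (hN : 1 ≤ N) {κ : ℝ × ℝ} (w : Fin 2 → ℤ) {Ψ : ℤ → ℂ}
    (hΨ : Ψ ∈ torusStates N κ) : shiftOp N κ w Ψ ∈ torusStates N κ := by
  intro k
  have hstep (k : ℤ) : Ψ (k + N) = Complex.exp (-(2 * π * I * κ.2)) * Ψ k := hΨ k
  have hN' : (N : ℂ) ≠ 0 := by exact_mod_cast Nat.one_le_iff_ne_zero.1 hN
  rw [shiftOp_apply, shiftOp_apply, add_right_comm, hstep, mul_left_comm]
  congr 2
  rw [Complex.exp_eq_exp_iff_exists_int]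
  refine ⟨-w 1, ?_⟩
  push_cast
  field_simp
  ring

theorem pairing_weyl {N : ℕ} (hN : 1 ≤ N) (κ : ℝ × ℝ) (w : Fin 2 → ℤ) (Ψ : ℤ → ℂ) (f : 𝓢(ℝ, ℂ)) :
    pairing N κ Ψ (weyl N (fun i => w i / N) f) = pairing N κ (shiftOp N κ w Ψ) f := by
  have hN' : (N : ℝ) ≠ 0 := by positivity
  rw [pairing, ← (Equiv.addRight (w 0)).tsum_eq, pairing]
  congr 1
  ext k
  have hshift : ((k + w 0 : ℤ) + κ.1) / N - w 0 / N = (k + κ.1) / N := by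
    push_cast
    field_simp
    ring
  simp only [Equiv.coe_addRight, weyl_apply, shiftOp_apply, map_mul, ← Complex.exp_conj,
    Complex.conj_I, Complex.conj_ofReal, hshift]
  rw [mul_left_comm, ← mul_assoc]
  congr 2
  push_cast
  field_simp
  ring_nf

theorem IsImage.shiftOp {N : ℕ} (hN : 1 ≤ N) {M : Matrix.SpecialLinearGroup (Fin 2) ℤ} {ε : ℤˣ}
    {a b c : ℝ} (hgen : IsGenerator M ε a b c) {κ : ℝ × ℝ} {Ψ Φ : ℤ → ℂ}
    (h : IsImage N ε a b c κ Ψ Φ) (w : Fin 2 → ℤ) :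
    IsImage N ε a b c κ (QuantumCat.shiftOp N κ w Ψ)
      (QuantumCat.shiftOp N κ ((M : Matrix (Fin 2) (Fin 2) ℤ).mulVec w) Φ) := by
  intro f
  have hw : ((M : Matrix (Fin 2) (Fin 2) ℤ).map (Int.cast : ℤ → ℝ)).mulVec
      (fun i => (w i / N : ℝ)) =
      fun i => (((M : Matrix (Fin 2) (Fin 2) ℤ).mulVec w i : ℤ) : ℝ) / N := by
    ext i
    simp [Matrix.mulVec, dotProduct, Fin.sum_univ_two]
    ring
  rw [← pairing_weyl hN, ← pairing_weyl hN, ← h, intertwines_quantization hN hgen, hw]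

/-! ### Orthonormal bases of states -/

theorem stateInner_smul (N : ℕ) (z : ℂ) (Ψ Φ : ℤ → ℂ) :
    stateInner N (z • Ψ) Φ = z * stateInner N Ψ Φ := by
  simp only [stateInner, Pi.smul_apply, smul_eq_mul, mul_assoc, ← Finset.mul_sum, mul_left_comm]

theorem stateInner_sum (N : ℕ) {ι : Type*} (s : Finset ι) (Ψ : ι → ℤ → ℂ) (Φ : ℤ → ℂ) :
    stateInner N (∑ j ∈ s, Ψ j) Φ = ∑ j ∈ s, stateInner N (Ψ j) Φ := by
  simp only [stateInner, Finset.sum_apply, Finset.sum_mul, ← Finset.mul_sum]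
  rw [Finset.sum_comm]

section Basis

variable {N : ℕ} {κ : ℝ × ℝ} {φ : Fin N → ℤ → ℂ}

-- A one-sided inverse of a square matrix is two-sided: orthonormal rows give orthonormal columns.
theorem sum_mul_conj_eq_ite (hon : ∀ i j, stateInner N (φ i) (φ j) = if i = j then 1 else 0)
    {k l : ℕ} (hk : k ∈ Finset.Icc 1 N) (hl : l ∈ Finset.Icc 1 N) :
    ∑ j, φ j (k : ℤ) * conj (φ j (l : ℤ)) = if k = l then (N : ℂ) else 0 := by
  have hN : (N : ℂ) ≠ 0 := by
    rw [Finset.mem_Icc] at hk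
    exact_mod_cast (by lia : N ≠ 0)
  let U : Matrix (Fin N) (Finset.Icc 1 N) ℂ := fun j k => (N : ℂ)⁻¹ * φ j (k : ℕ)
  let V : Matrix (Finset.Icc 1 N) (Fin N) ℂ := fun k j => conj (φ j (k : ℕ))
  have hUV : U * V = 1 := by
    ext i j
    rw [Matrix.mul_apply, Matrix.one_apply, ← hon i j, stateInner, one_div, Finset.mul_sum]
    simp only [U, V, mul_assoc]
    exact Finset.sum_coe_sort (Finset.Icc 1 N) fun k => (N : ℂ)⁻¹ * (φ i k * conj (φ j k))
  have hVU : V * U = 1 := (Matrix.mul_eq_one_comm_of_card_eq _ _ _ (by simp)).1 hUV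
  have hlk := congrFun (congrFun hVU ⟨l, hl⟩) ⟨k, hk⟩
  rw [Matrix.mul_apply, Matrix.one_apply] at hlk
  calc ∑ j, φ j (k : ℤ) * conj (φ j (l : ℤ))
      = N * ∑ j, conj (φ j (l : ℤ)) * ((N : ℂ)⁻¹ * φ j (k : ℤ)) := by
        rw [Finset.mul_sum]
        exact Finset.sum_congr rfl fun j _ => by field_simp
    _ = if k = l then (N : ℂ) else 0 := by
        rw [hlk]
        simp [eq_comm]

theorem sum_mul_conj_eq_zero (hN : 1 ≤ N) (hmem : ∀ j, φ j ∈ torusStates N κ)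
    (hon : ∀ i j, stateInner N (φ i) (φ j) = if i = j then 1 else 0) {k l : ℤ}
    (hkl : ¬ (N : ℤ) ∣ k - l) : ∑ j, φ j k * conj (φ j l) = 0 := by
  obtain ⟨k', hk', y, rfl⟩ := exists_eq_natCast_add_int_mul hN k
  obtain ⟨l', hl', z, rfl⟩ := exists_eq_natCast_add_int_mul hN l
  have hne : k' ≠ l' := by
    rintro rfl
    exact hkl ⟨y - z, by ring⟩
  simp only [torusStates_add_int_mul (hmem _), map_mul, mul_mul_mul_comm _ (φ _ _)]
  rw [← Finset.mul_sum, sum_mul_conj_eq_ite hon hk' hl', if_neg hne, mul_zero]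

theorem sum_norm_sq_apply (hN : 1 ≤ N) (hmem : ∀ j, φ j ∈ torusStates N κ)
    (hon : ∀ i j, stateInner N (φ i) (φ j) = if i = j then 1 else 0) (k : ℤ) :
    ∑ j, ‖φ j k‖ ^ 2 = N := by
  obtain ⟨l, hl, z, rfl⟩ := exists_eq_natCast_add_int_mul hN k
  simp only [norm_torusStates_add_int_mul (hmem _)]
  have h := sum_mul_conj_eq_ite hon hl hl
  simp only [Complex.mul_conj', if_true] at h
  exact_mod_cast h

theorem sum_stateInner_smul (hN : 1 ≤ N) (hmem : ∀ j, φ j ∈ torusStates N κ)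
    (hon : ∀ i j, stateInner N (φ i) (φ j) = if i = j then 1 else 0) {Ψ : ℤ → ℂ}
    (hΨ : Ψ ∈ torusStates N κ) : ∑ j, stateInner N Ψ (φ j) • φ j = Ψ := by
  refine torusStates_ext hN (Submodule.sum_mem _ fun j _ => Submodule.smul_mem _ _ (hmem j)) hΨ
    fun k hk => ?_
  have hN' : (N : ℂ) ≠ 0 := by exact_mod_cast Nat.one_le_iff_ne_zero.1 hN
  calc (∑ j, stateInner N Ψ (φ j) • φ j) (k : ℤ)
      = 1 / N * ∑ l ∈ Finset.Icc 1 N, Ψ (l : ℤ) * ∑ j, φ j (k : ℤ) * conj (φ j (l : ℤ)) := by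
        simp only [Finset.sum_apply, Pi.smul_apply, smul_eq_mul, stateInner, mul_assoc,
          ← Finset.mul_sum, Finset.sum_mul]
        rw [Finset.sum_comm]
        simp only [mul_comm (conj _), ← Finset.mul_sum]
    _ = 1 / N * ∑ l ∈ Finset.Icc 1 N, Ψ (l : ℤ) * if k = l then (N : ℂ) else 0 := by
        congr 1
        exact Finset.sum_congr rfl fun l hl => by rw [sum_mul_conj_eq_ite hon hk hl]
    _ = Ψ (k : ℤ) := by
        simp only [mul_ite, mul_zero, Finset.sum_ite_eq, if_pos hk]
        field_simp

theorem stateInner_isImage (hN : 1 ≤ N) {ε : ℤˣ} {a b c : ℝ} (hyp : a * b < c ^ 2)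
    (hφ : IsEigenbasis N ε a b c κ φ) {i : Fin N} {z : ℂ}
    (hz : IsImage N ε a b c κ (φ i) (z • φ i)) {Ψ Φ : ℤ → ℂ} (hΨ : Ψ ∈ torusStates N κ)
    (h : IsImage N ε a b c κ Ψ Φ) : stateInner N Φ (φ i) = z * stateInner N Ψ (φ i) := by
  choose θ hθ using hφ.eigen
  have hzi : z • φ i = Complex.exp (I * θ i) • φ i := hz.unique hN hyp (hθ i)
  set d : Fin N → ℂ := fun j => stateInner N Ψ (φ j)
  have hexpand : IsImage N ε a b c κ (∑ j, d j • φ j)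
      (∑ j, d j • Complex.exp (I * θ j) • φ j) :=
    IsImage.sum hN (fun j _ => Submodule.smul_mem _ _ (hφ.mem j))
      (fun j _ => Submodule.smul_mem _ _ (Submodule.smul_mem _ _ (hφ.mem j)))
      fun j _ => (hθ j).smul (d j)
  rw [sum_stateInner_smul hN hφ.mem hφ.orthonormal hΨ] at hexpand
  have hz' := congrArg (stateInner N · (φ i)) hzi
  simp only [stateInner_smul, hφ.orthonormal, if_true, mul_one] at hz'
  rw [h.unique hN hyp hexpand, hz']
  simp only [stateInner_sum, stateInner_smul, hφ.orthonormal, mul_ite, mul_one, mul_zero,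
    Finset.sum_ite_eq', Finset.mem_univ, if_true, d]
  ring

theorem stateInner_shiftOp_mulVec (hN : 1 ≤ N) {M : Matrix.SpecialLinearGroup (Fin 2) ℤ} {ε : ℤˣ}
    {a b c : ℝ} (hgen : IsGenerator M ε a b c) (hφ : IsEigenbasis N ε a b c κ φ)
    (w : Fin 2 → ℤ) (i : Fin N) :
    stateInner N (shiftOp N κ ((M : Matrix (Fin 2) (Fin 2) ℤ).mulVec w) (φ i)) (φ i) =
      stateInner N (shiftOp N κ w (φ i)) (φ i) := by
  obtain ⟨θ, hθ⟩ := hφ.eigen i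
  have h := stateInner_isImage hN hgen.hyperbolic hφ hθ (shiftOp_mem hN w (hφ.mem i))
    (hθ.shiftOp hN hgen w)
  rw [map_smul, stateInner_smul] at h
  exact mul_left_cancel₀ (Complex.exp_ne_zero _) h

theorem stateInner_shiftOp_pow_mulVec (hN : 1 ≤ N) {M : Matrix.SpecialLinearGroup (Fin 2) ℤ}
    {ε : ℤˣ} {a b c : ℝ} (hgen : IsGenerator M ε a b c) (hφ : IsEigenbasis N ε a b c κ φ)
    (w : Fin 2 → ℤ) (i : Fin N) (t : ℕ) :
    stateInner N (shiftOp N κ (((M : Matrix (Fin 2) (Fin 2) ℤ) ^ t).mulVec w) (φ i)) (φ i) =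
      stateInner N (shiftOp N κ w (φ i)) (φ i) := by
  induction t with
  | zero => rw [pow_zero, Matrix.one_mulVec]
  | succ t ih => rw [pow_succ', ← Matrix.mulVec_mulVec, stateInner_shiftOp_mulVec hN hgen hφ, ih]

end Basis

/-! ### Orbits modulo `N` -/

section Recurrence

variable {a : ℕ → ℤ} {τ : ℤ}

theorem abs_strictMono_of_recurrence (hτ : 2 < |τ|) (h0 : a 0 = 0) (h1 : a 1 ≠ 0)
    (hrec : ∀ t, a (t + 2) = τ * a (t + 1) - a t) : StrictMono fun t => |a t| := by
  refine strictMono_nat_of_lt_succ fun t => ?_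
  induction t with
  | zero => simpa [h0] using h1
  | succ t ih =>
    have h := abs_sub_abs_le_abs_sub (τ * a (t + 1)) (a t)
    rw [abs_mul] at h
    simp only [hrec]
    nlinarith [abs_nonneg (a t), abs_nonneg (a (t + 1))]

theorem abs_succ_le_of_recurrence (hτ : 2 < |τ|) (h0 : a 0 = 0) (h1 : a 1 ≠ 0)
    (hrec : ∀ t, a (t + 2) = τ * a (t + 1) - a t) (t : ℕ) :
    |a (t + 1)| ≤ (|τ| + 1) ^ t * |a 1| := by
  induction t with
  | zero => simp
  | succ t ih =>
    have hlt : |a t| < |a (t + 1)| := abs_strictMono_of_recurrence hτ h0 h1 hrec t.lt_succ_self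
    calc |a (t + 2)| ≤ |τ| * |a (t + 1)| + |a t| := by
          rw [hrec, ← abs_mul]
          exact abs_sub _ _
      _ ≤ (|τ| + 1) * |a (t + 1)| := by linarith
      _ ≤ (|τ| + 1) * ((|τ| + 1) ^ t * |a 1|) := by gcongr
      _ = (|τ| + 1) ^ (t + 1) * |a 1| := by ring

end Recurrence

theorem offDiag_ne_zero {M : Matrix (Fin 2) (Fin 2) ℤ} (hdet : M.det = 1) (hM : 2 < |M.trace|) :
    M 0 1 ≠ 0 := by
  intro h
  rw [Matrix.det_fin_two, h, zero_mul, sub_zero] at hdet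
  rw [Matrix.trace_fin_two] at hM
  rcases Int.mul_eq_one_iff_eq_one_or_neg_one.1 hdet with ⟨h1, h2⟩ | ⟨h1, h2⟩ <;>
    norm_num [h1, h2] at hM

/-- The first coordinate of the point `M ^ t (0, n)` of the orbit of `(0, n)` under `M`. -/
def orbitCoord (M : Matrix (Fin 2) (Fin 2) ℤ) (n : ℤ) (t : ℕ) : ℤ := (M ^ t).mulVec ![0, n] 0

theorem orbitCoord_zero (M : Matrix (Fin 2) (Fin 2) ℤ) (n : ℤ) : orbitCoord M n 0 = 0 := by
  simp [orbitCoord]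

theorem orbitCoord_one (M : Matrix (Fin 2) (Fin 2) ℤ) (n : ℤ) : orbitCoord M n 1 = M 0 1 * n := by
  simp [orbitCoord, Matrix.mulVec, dotProduct, Fin.sum_univ_two]

theorem orbitCoord_add_two {M : Matrix (Fin 2) (Fin 2) ℤ} (hdet : M.det = 1) (n : ℤ) (t : ℕ) :
    orbitCoord M n (t + 2) = M.trace * orbitCoord M n (t + 1) - orbitCoord M n t := by
  have hcayley : M ^ 2 = M.trace • M - 1 := by
    have h := M.aeval_self_charpoly
    simp only [M.charpoly_fin_two, hdet, map_add, map_sub, map_pow, map_mul, Polynomial.aeval_X,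
      Polynomial.aeval_C, map_one, ← Algebra.smul_def] at h
    rw [← sub_eq_zero, ← h]
    abel
  have hpow : M ^ (t + 2) = M.trace • M ^ (t + 1) - M ^ t := by
    rw [pow_add, hcayley, mul_sub, mul_one, mul_smul_comm, pow_succ]
  simp only [orbitCoord, hpow, Matrix.sub_mulVec, Matrix.smul_mulVec, Pi.sub_apply, Pi.smul_apply,
    smul_eq_mul]

theorem not_dvd_orbitCoord_sub {M : Matrix (Fin 2) (Fin 2) ℤ} (hdet : M.det = 1)
    (hM : 2 < |M.trace|) {n : ℤ} (hn : n ≠ 0) {N T : ℕ}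
    (hN : 2 * ((|M.trace| + 1) ^ T * |M 0 1 * n|) < N) {s t : ℕ} (hs : s ≤ T + 1) (ht : t ≤ T + 1)
    (hst : s ≠ t) : ¬ (N : ℤ) ∣ orbitCoord M n s - orbitCoord M n t := by
  have h0 := orbitCoord_zero M n
  have h1 : orbitCoord M n 1 ≠ 0 := by
    rw [orbitCoord_one]
    exact mul_ne_zero (offDiag_ne_zero hdet hM) hn
  have hrec := orbitCoord_add_two hdet n
  have hmono := abs_strictMono_of_recurrence hM h0 h1 hrec
  have hle {t : ℕ} (ht : t ≤ T + 1) : |orbitCoord M n t| ≤ (|M.trace| + 1) ^ T * |M 0 1 * n| := by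
    rw [← orbitCoord_one]
    exact (hmono.monotone ht).trans (abs_succ_le_of_recurrence hM h0 h1 hrec T)
  intro hdvd
  have hlt : |orbitCoord M n s - orbitCoord M n t| < N :=
    (abs_sub _ _).trans_lt (by linarith [hle hs, hle ht])
  have hzero := Int.eq_zero_of_abs_lt_dvd hdvd hlt
  exact hst (hmono.injective (by simp only [sub_eq_zero.1 hzero]))

/-! ### The quantum variance -/

theorem norm_sq_stateInner_le {N : ℕ} (Ψ : ℤ → ℂ) {Φ : ℤ → ℂ} (hΦ : stateInner N Φ Φ = 1) :
    ‖stateInner N Ψ Φ‖ ^ 2 ≤ (1 / N : ℝ) * ∑ k ∈ Finset.Icc 1 N, ‖Ψ (k : ℤ)‖ ^ 2 := by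
  have hΦ' : (1 / N : ℝ) * ∑ k ∈ Finset.Icc 1 N, ‖Φ (k : ℤ)‖ ^ 2 = 1 := by
    simp only [stateInner, Complex.mul_conj'] at hΦ
    rw [← Complex.ofReal_inj]
    push_cast
    exact hΦ
  have hle : ‖stateInner N Ψ Φ‖ ≤
      (1 / N : ℝ) * ∑ k ∈ Finset.Icc 1 N, ‖Ψ (k : ℤ)‖ * ‖Φ (k : ℤ)‖ := by
    rw [stateInner, norm_mul, norm_div, norm_one, Complex.norm_natCast]
    gcongr
    refine (norm_sum_le _ _).trans_eq ?_
    simp only [norm_mul, RCLike.norm_conj]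
  calc ‖stateInner N Ψ Φ‖ ^ 2
      ≤ ((1 / N : ℝ) * ∑ k ∈ Finset.Icc 1 N, ‖Ψ (k : ℤ)‖ * ‖Φ (k : ℤ)‖) ^ 2 := by gcongr
    _ ≤ (1 / N : ℝ) ^ 2 * ((∑ k ∈ Finset.Icc 1 N, ‖Ψ (k : ℤ)‖ ^ 2) *
          ∑ k ∈ Finset.Icc 1 N, ‖Φ (k : ℤ)‖ ^ 2) := by
        rw [mul_pow]
        gcongr
        exact Finset.sum_mul_sq_le_sq_mul_sq _ _ _
    _ = (1 / N : ℝ) * ∑ k ∈ Finset.Icc 1 N, ‖Ψ (k : ℤ)‖ ^ 2 := by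
        linear_combination (1 / N : ℝ) * (∑ k ∈ Finset.Icc 1 N, ‖Ψ (k : ℤ)‖ ^ 2) * hΦ'

theorem norm_shiftOp_apply (N : ℕ) (κ : ℝ × ℝ) (w : Fin 2 → ℤ) (Ψ : ℤ → ℂ) (k : ℤ) :
    ‖shiftOp N κ w Ψ k‖ = ‖Ψ (k + w 0)‖ := by
  have hphase : -(2 * π * I * w 1 * (k + κ.1) / N + π * I * w 0 * w 1 / N) =
      ((-(2 * π * w 1 * (k + κ.1) / N + π * w 0 * w 1 / N) : ℝ) : ℂ) * I := by
    push_cast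
    ring
  rw [shiftOp_apply, norm_mul, hphase, Complex.norm_exp_ofReal_mul_I, one_mul]

section Variance

variable {N : ℕ} {κ : ℝ × ℝ} {φ : Fin N → ℤ → ℂ}

theorem sum_shiftOp_mul_conj_eq_zero (hN : 1 ≤ N) (hmem : ∀ j, φ j ∈ torusStates N κ)
    (hon : ∀ i j, stateInner N (φ i) (φ j) = if i = j then 1 else 0) {v w : Fin 2 → ℤ}
    (hvw : ¬ (N : ℤ) ∣ v 0 - w 0) (k : ℤ) :
    ∑ j, shiftOp N κ v (φ j) k * conj (shiftOp N κ w (φ j) k) = 0 := by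
  simp only [shiftOp_apply, map_mul, mul_mul_mul_comm _ (φ _ _)]
  rw [← Finset.mul_sum, sum_mul_conj_eq_zero hN hmem hon (by rwa [add_sub_add_left_eq_sub]),
    mul_zero]

theorem sum_norm_sq_sum_shiftOp (hN : 1 ≤ N) (hmem : ∀ j, φ j ∈ torusStates N κ)
    (hon : ∀ i j, stateInner N (φ i) (φ j) = if i = j then 1 else 0) {ι : Type*} {s : Finset ι}
    {w : ι → Fin 2 → ℤ} (hw : (s : Set ι).Pairwise fun t u => ¬ (N : ℤ) ∣ w t 0 - w u 0) (k : ℤ) :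
    ∑ j, ‖(∑ t ∈ s, shiftOp N κ (w t) (φ j)) k‖ ^ 2 = s.card * N := by
  classical
  have hinner {t u : ι} (ht : t ∈ s) (hu : u ∈ s) :
      ∑ j, shiftOp N κ (w t) (φ j) k * conj (shiftOp N κ (w u) (φ j) k) =
        if t = u then (N : ℂ) else 0 := by
    split_ifs with htu
    · simp only [htu, Complex.mul_conj', norm_shiftOp_apply]
      exact_mod_cast sum_norm_sq_apply hN hmem hon (k + w u 0)
    · exact sum_shiftOp_mul_conj_eq_zero hN hmem hon (hw ht hu htu) k
  suffices h : ∑ j, ((‖(∑ t ∈ s, shiftOp N κ (w t) (φ j)) k‖ : ℂ)) ^ 2 = s.card * N by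
    exact_mod_cast h
  calc ∑ j, ((‖(∑ t ∈ s, shiftOp N κ (w t) (φ j)) k‖ : ℂ)) ^ 2
      = ∑ t ∈ s, ∑ u ∈ s, ∑ j, shiftOp N κ (w t) (φ j) k * conj (shiftOp N κ (w u) (φ j) k) := by
        simp only [← Complex.mul_conj', Finset.sum_apply, map_sum, Finset.sum_mul_sum]
        rw [Finset.sum_comm]
        exact Finset.sum_congr rfl fun t _ => Finset.sum_comm
    _ = ∑ t ∈ s, ∑ u ∈ s, if t = u then (N : ℂ) else 0 :=
        Finset.sum_congr rfl fun t ht => Finset.sum_congr rfl fun u hu => hinner ht hu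
    _ = s.card * N := by simp +contextual

theorem sum_norm_sq_le_of_stateInner_shiftOp (hN : 1 ≤ N) (hmem : ∀ j, φ j ∈ torusStates N κ)
    (hon : ∀ i j, stateInner N (φ i) (φ j) = if i = j then 1 else 0) {ι : Type*} {s : Finset ι}
    (hs : s.Nonempty) {w : ι → Fin 2 → ℤ}
    (hw : (s : Set ι).Pairwise fun t u => ¬ (N : ℤ) ∣ w t 0 - w u 0) {z : Fin N → ℂ}
    (hz : ∀ j, ∀ t ∈ s, stateInner N (shiftOp N κ (w t) (φ j)) (φ j) = z j) :
    ∑ j, ‖z j‖ ^ 2 ≤ N / s.card := by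
  have hcard : (0 : ℝ) < s.card := by exact_mod_cast hs.card_pos
  set Ψ : Fin N → ℤ → ℂ := fun j => ∑ t ∈ s, shiftOp N κ (w t) (φ j)
  have hmean (j : Fin N) : stateInner N (Ψ j) (φ j) = s.card * z j := by
    rw [stateInner_sum, Finset.sum_congr rfl (hz j), Finset.sum_const, nsmul_eq_mul]
  have hbound : (s.card : ℝ) ^ 2 * ∑ j, ‖z j‖ ^ 2 ≤ s.card * N := by
    calc (s.card : ℝ) ^ 2 * ∑ j, ‖z j‖ ^ 2 = ∑ j, ‖stateInner N (Ψ j) (φ j)‖ ^ 2 := by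
          simp only [hmean, norm_mul, mul_pow, Complex.norm_natCast, Finset.mul_sum]
      _ ≤ ∑ j, (1 / N : ℝ) * ∑ k ∈ Finset.Icc 1 N, ‖Ψ j (k : ℤ)‖ ^ 2 :=
          Finset.sum_le_sum fun j _ => norm_sq_stateInner_le _ (by rw [hon, if_pos rfl])
      _ = (1 / N : ℝ) * ∑ k ∈ Finset.Icc 1 N, ∑ j, ‖Ψ j (k : ℤ)‖ ^ 2 := by
          rw [← Finset.mul_sum, Finset.sum_comm]
      _ = s.card * N := by
          simp only [Ψ, sum_norm_sq_sum_shiftOp hN hmem hon hw, Finset.sum_const, Nat.card_Icc,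
            add_tsub_cancel_right, nsmul_eq_mul]
          field_simp
  rw [le_div_iff₀ hcard]
  nlinarith

theorem sum_norm_sq_stateInner_shiftOp_le (hN : 1 ≤ N) {M : Matrix.SpecialLinearGroup (Fin 2) ℤ}
    (hM : 2 < |(M : Matrix (Fin 2) (Fin 2) ℤ).trace|) {ε : ℤˣ} {a b c : ℝ}
    (hgen : IsGenerator M ε a b c) (hφ : IsEigenbasis N ε a b c κ φ) {n : ℤ} (hn : n ≠ 0) {T : ℕ}
    (hT : 2 * ((|(M : Matrix (Fin 2) (Fin 2) ℤ).trace| + 1) ^ T *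
      |(M : Matrix (Fin 2) (Fin 2) ℤ) 0 1 * n|) < N) :
    ∑ j, ‖stateInner N (shiftOp N κ ![0, n] (φ j)) (φ j)‖ ^ 2 ≤ N / (T + 1) := by
  have h := sum_norm_sq_le_of_stateInner_shiftOp hN hφ.mem hφ.orthonormal
    (s := Finset.range (T + 1)) Finset.nonempty_range_add_one
    (w := fun t => ((M : Matrix (Fin 2) (Fin 2) ℤ) ^ t).mulVec ![0, n])
    (fun t ht u hu htu => not_dvd_orbitCoord_sub M.det_coe hM hn hT
      (Finset.mem_range.1 ht).le (Finset.mem_range.1 hu).le htu)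
    (fun j t _ => stateInner_shiftOp_pow_mulVec hN hgen hφ _ j t)
  rwa [Finset.card_range, Nat.cast_succ] at h

end Variance

-- With `R ^ (4 * T) ≤ N` and `|n| ≤ √N`, the left-hand side is at most `K * N ^ (3 / 4)`.
theorem mul_pow_log_lt {K R N : ℕ} {n : ℤ} (hK : K ^ 4 < N) (hn : n ^ 2 ≤ N) :
    K * (R ^ Nat.log (R ^ 4) N * |n|) < (N : ℤ) := by
  have hR : ((R : ℤ) ^ Nat.log (R ^ 4) N) ^ 4 ≤ N := by
    have h := Nat.pow_log_le_self (R ^ 4) (Nat.ne_zero_of_lt hK)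
    rw [← pow_mul, mul_comm, pow_mul] at h
    exact_mod_cast h
  refine lt_of_pow_lt_pow_left₀ 4 (by positivity) ?_
  calc (K * (R ^ Nat.log (R ^ 4) N * |n|) : ℤ) ^ 4
      = K ^ 4 * (((R : ℤ) ^ Nat.log (R ^ 4) N) ^ 4 * (n ^ 2) ^ 2) := by
        rw [← sq_abs n]
        ring
    _ ≤ K ^ 4 * ((N : ℤ) * N ^ 2) := by gcongr
    _ < N * ((N : ℤ) * N ^ 2) := by
        have : (0 : ℤ) < N := by exact_mod_cast Nat.zero_lt_of_lt hK
        gcongr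
        exact_mod_cast hK
    _ = (N : ℤ) ^ 4 := by ring

theorem log_le_natLog_add_one_mul {b N : ℕ} (hb : 1 < b) :
    Real.log N ≤ (Nat.log b N + 1) * Real.log b := by
  rcases N.eq_zero_or_pos with rfl | hN
  · simpa using Real.log_nonneg (by exact_mod_cast hb.le)
  have h : (N : ℝ) ≤ b ^ (Nat.log b N + 1) := by exact_mod_cast (Nat.lt_pow_succ_log_self hb N).le
  calc Real.log N ≤ Real.log (b ^ (Nat.log b N + 1)) := Real.log_le_log (by exact_mod_cast hN) h
    _ = (Nat.log b N + 1) * Real.log b := by rw [Real.log_pow]; push_cast; rfl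

theorem exists_eventually_sum_norm_sq_stateInner_le {M : Matrix.SpecialLinearGroup (Fin 2) ℤ}
    (hM : 2 < |(M : Matrix (Fin 2) (Fin 2) ℤ).trace|) {ε : ℤˣ} {a b c : ℝ}
    (hgen : IsGenerator M ε a b c) :
    ∃ C > 0, ∀ᶠ N : ℕ in atTop, ∀ (κ : ℝ × ℝ) (φ : Fin N → ℤ → ℂ), IsEigenbasis N ε a b c κ φ →
      ∀ n : ℤ, n ≠ 0 → n ^ 2 ≤ N →
        ∑ j, ‖stateInner N (shiftOp N κ ![0, n] (φ j)) (φ j)‖ ^ 2 ≤ C * N / Real.log N := by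
  set R := (M : Matrix (Fin 2) (Fin 2) ℤ).trace.natAbs + 1 with hRdef
  have hRcast : (R : ℤ) = |(M : Matrix (Fin 2) (Fin 2) ℤ).trace| + 1 := by simp [hRdef]
  set K := 2 * ((M : Matrix (Fin 2) (Fin 2) ℤ) 0 1).natAbs with hKdef
  have hR : 1 < R ^ 4 := Nat.one_lt_pow (by norm_num) (by lia)
  have hC : 0 < Real.log (R ^ 4 : ℕ) := Real.log_pos (by exact_mod_cast hR)
  refine ⟨Real.log (R ^ 4 : ℕ), hC, ?_⟩
  filter_upwards [eventually_gt_atTop (K ^ 4), eventually_gt_atTop 1] with N hK hN κ φ hφ n hn hnN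
  have hT := mul_pow_log_lt (R := R) hK hnN
  have hvar := sum_norm_sq_stateInner_shiftOp_le hN.le hM hgen hφ hn (T := Nat.log (R ^ 4) N) <| by
    convert hT using 1
    rw [hRcast, hKdef, abs_mul]
    push_cast
    ring
  refine hvar.trans ?_
  have hlog : 0 < Real.log N := Real.log_pos (by exact_mod_cast hN)
  rw [div_le_div_iff₀ (by positivity) hlog]
  calc (N : ℝ) * Real.log N ≤ N * ((Nat.log (R ^ 4) N + 1) * Real.log (R ^ 4 : ℕ)) := by
        gcongr
        exact log_le_natLog_add_one_mul hR
    _ = Real.log (R ^ 4 : ℕ) * N * (Nat.log (R ^ 4) N + 1) := by ring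

/-! ### Trapezoidal cutoffs and their cosine series -/

theorem hasSum_cos_div_sq {x : ℝ} (h0 : 0 ≤ x) (h1 : x ≤ 1) :
    HasSum (fun n : ℕ => 1 / (n : ℝ) ^ 2 * Real.cos (2 * π * n * x))
      (π ^ 2 * (x ^ 2 - x + 6⁻¹)) := by
  have h := hasSum_one_div_nat_pow_mul_cos (k := 1) one_ne_zero (x := x) ⟨h0, h1⟩
  simp only [mul_one, ← bernoulliFun.eq_1, bernoulliFun_two] at h
  convert h using 1
  simp only [Nat.factorial]
  push_cast
  ring

/-- The function equal to `1` on `(-∞, r]`, to `0` on `[s, ∞)` and affine on `[r, s]`. -/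
def trapezoid (r s y : ℝ) : ℝ := (max y s - max y r) / (s - r)

/-- The `n`-th coefficient of the cosine series of the 1-periodic even function equal to
`trapezoid r s` on `[0, 1 / 2]`. The constant term `r + s` is left out: the value at `n = 0`
is `0`. -/
def trapezoidCoeff (r s : ℝ) (n : ℕ) : ℝ :=
  (Real.cos (2 * π * n * r) - Real.cos (2 * π * n * s)) / (π ^ 2 * (s - r) * n ^ 2)

section Trapezoid

variable {r s : ℝ}

theorem continuous_trapezoid (r s : ℝ) : Continuous (trapezoid r s) := by
  unfold trapezoid
  fun_prop

theorem trapezoid_nonneg (hrs : r < s) (y : ℝ) : 0 ≤ trapezoid r s y :=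
  div_nonneg (sub_nonneg.2 (max_le_max_left y hrs.le)) (sub_nonneg.2 hrs.le)

theorem trapezoid_le_one (hrs : r < s) (y : ℝ) : trapezoid r s y ≤ 1 := by
  rw [trapezoid, div_le_one (by linarith), sub_le_iff_le_add]
  exact max_le (by linarith [le_max_left y r]) (by linarith [le_max_right y r])

theorem trapezoid_eq_one (hrs : r < s) {y : ℝ} (hy : y ≤ r) : trapezoid r s y = 1 := by
  rw [trapezoid, max_eq_right hy, max_eq_right (hy.trans hrs.le), div_self (by linarith)]

theorem trapezoid_eq_zero (hrs : r < s) {y : ℝ} (hy : s ≤ y) : trapezoid r s y = 0 := by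
  rw [trapezoid, max_eq_left hy, max_eq_left (hrs.le.trans hy), sub_self, zero_div]

theorem trapezoidCoeff_zero (r s : ℝ) : trapezoidCoeff r s 0 = 0 := by simp [trapezoidCoeff]

theorem hasSum_cos_mul_cos_div_sq {t y : ℝ} (ht : 0 ≤ t) (ht1 : t ≤ 1 / 2) (hy : 0 ≤ y)
    (hy1 : y ≤ 1 / 2) :
    HasSum (fun n : ℕ => Real.cos (2 * π * n * t) * Real.cos (2 * π * n * y) / n ^ 2)
      (π ^ 2 * (y ^ 2 + t ^ 2 - max y t + 6⁻¹)) := by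
  have hadd := hasSum_cos_div_sq (x := y + t) (by linarith) (by linarith)
  have hsub := hasSum_cos_div_sq (x := |y - t|) (abs_nonneg _)
    (abs_le.2 ⟨by linarith, by linarith⟩)
  have hvalue : π ^ 2 * (y ^ 2 + t ^ 2 - max y t + 6⁻¹) = (π ^ 2 * ((y + t) ^ 2 - (y + t) + 6⁻¹) +
      π ^ 2 * (|y - t| ^ 2 - |y - t| + 6⁻¹)) / 2 := by
    rw [sq_abs, max_def', abs_eq_max_neg, max_def']
    split_ifs <;> linarith
  rw [hvalue]
  refine ((hadd.add hsub).div_const 2).congr_fun fun n => ?_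
  have hcos : Real.cos (2 * π * n * |y - t|) = Real.cos (2 * π * n * (y - t)) := by
    rcases abs_choice (y - t) with h | h <;> rw [h]
    rw [mul_neg, Real.cos_neg]
  rw [hcos, mul_add, mul_sub, Real.cos_add, Real.cos_sub]
  ring

theorem hasSum_trapezoidCoeff_mul_cos (hr : 0 ≤ r) (hrs : r < s) (hs : s ≤ 1 / 2) {y : ℝ}
    (hy : 0 ≤ y) (hy1 : y ≤ 1 / 2) :
    HasSum (fun n : ℕ => trapezoidCoeff r s n * Real.cos (2 * π * n * y))
      (trapezoid r s y - (r + s)) := by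
  have hsr : s - r ≠ 0 := by linarith
  have hvalue : trapezoid r s y - (r + s) = (π ^ 2 * (y ^ 2 + r ^ 2 - max y r + 6⁻¹) -
      π ^ 2 * (y ^ 2 + s ^ 2 - max y s + 6⁻¹)) / (π ^ 2 * (s - r)) := by
    rw [trapezoid]
    field_simp
    ring
  rw [hvalue]
  refine (((hasSum_cos_mul_cos_div_sq hr (by linarith) hy hy1).sub
    (hasSum_cos_mul_cos_div_sq (hr.trans hrs.le) hs hy hy1)).div_const _).congr_fun fun n => ?_
  rw [trapezoidCoeff, ← sub_div, ← sub_mul, div_div, mul_comm ((n : ℝ) ^ 2), div_mul_eq_mul_div]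

theorem abs_trapezoidCoeff_le_div_sq (hrs : r < s) (n : ℕ) :
    |trapezoidCoeff r s n| ≤ 1 / (s - r) / n ^ 2 := by
  rcases n.eq_zero_or_pos with rfl | hn
  · simp [trapezoidCoeff]
  have hcos : |Real.cos (2 * π * n * r) - Real.cos (2 * π * n * s)| ≤ 1 + 1 :=
    (abs_sub _ _).trans (add_le_add (Real.abs_cos_le_one _) (Real.abs_cos_le_one _))
  rw [trapezoidCoeff, abs_div, abs_of_pos (a := π ^ 2 * (s - r) * n ^ 2) (by positivity), div_div,
    div_le_div_iff₀ (by positivity) (by positivity), mul_assoc (π ^ 2), one_mul]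
  gcongr
  nlinarith [Real.pi_gt_three]

-- The difference of cosines is a product of sines, each bounded by its argument.
theorem abs_trapezoidCoeff_le (hr : 0 ≤ r) (hrs : r < s) (n : ℕ) :
    |trapezoidCoeff r s n| ≤ 2 * (r + s) := by
  rcases n.eq_zero_or_pos with rfl | hn
  · rw [trapezoidCoeff_zero, abs_zero]
    linarith
  have hs0 : 0 ≤ s := hr.trans hrs.le
  have hadd : |Real.sin ((2 * π * n * r + 2 * π * n * s) / 2)| ≤ π * n * (r + s) := by
    refine Real.abs_sin_le_abs.trans_eq ?_
    rw [abs_of_nonneg (by positivity)]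
    ring
  have hsub : |Real.sin ((2 * π * n * r - 2 * π * n * s) / 2)| ≤ π * n * (s - r) := by
    refine Real.abs_sin_le_abs.trans_eq ?_
    rw [abs_of_nonpos (by nlinarith [mul_pos Real.pi_pos (Nat.cast_pos (α := ℝ).2 hn)])]
    ring
  rw [trapezoidCoeff, abs_div, abs_of_pos (a := π ^ 2 * (s - r) * n ^ 2) (by positivity),
    div_le_iff₀ (by positivity), Real.cos_sub_cos, abs_mul, abs_mul]
  calc |(-2 : ℝ)| * |Real.sin ((2 * π * n * r + 2 * π * n * s) / 2)| *
        |Real.sin ((2 * π * n * r - 2 * π * n * s) / 2)|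
      ≤ |(-2 : ℝ)| * (π * n * (r + s)) * (π * n * (s - r)) := by gcongr
    _ = 2 * (r + s) * (π ^ 2 * (s - r) * n ^ 2) := by
        rw [abs_neg, abs_two]
        ring

end Trapezoid

theorem norm_unitAddCircle_le (x : UnitAddCircle) : ‖x‖ ≤ 1 / 2 := by
  simpa using AddCircle.norm_le_half_period (p := (1 : ℝ)) (x := x) one_ne_zero

theorem cos_two_pi_mul_norm (n : ℕ) (x : UnitAddCircle) :
    Real.cos (2 * π * n * ‖x‖) = (fourier (-n : ℤ) x).re := by
  obtain ⟨x, rfl⟩ := QuotientAddGroup.mk_surjective x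
  have hexp : fourier (n : ℤ) (x : UnitAddCircle) = Complex.exp ((2 * π * n * x : ℝ) * I) := by
    rw [fourier_coe_apply]
    push_cast
    ring_nf
  have hn : 2 * π * (n : ℝ) * |x - round x| = |2 * π * n * x - (n * round x : ℤ) * (2 * π)| := by
    rw [← abs_of_nonneg (by positivity : 0 ≤ 2 * π * (n : ℝ)), ← abs_mul,
      abs_of_nonneg (by positivity : 0 ≤ 2 * π * (n : ℝ))]
    push_cast
    ring_nf
  rw [fourier_neg, Complex.conj_re, hexp, Complex.exp_ofReal_mul_I_re, UnitAddCircle.norm_eq, hn,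
    Real.cos_abs, Real.cos_sub_int_mul_two_pi]

/-! ### Mass of balls and Fourier coefficients of probability measures on the circle -/

theorem sum_le_sum_Icc_add_div {f : ℕ → ℝ} {A : ℝ} {L : ℕ} (hL : 1 ≤ L) (hf : ∀ n, 0 ≤ f n)
    (h0 : f 0 = 0) (htail : ∀ n, L < n → f n ≤ A / n ^ 2) (s : Finset ℕ) :
    ∑ n ∈ s, f n ≤ ∑ n ∈ Finset.Icc 1 L, f n + A / L := by
  have hA : 0 ≤ A := by
    have h := (hf _).trans (htail _ L.lt_succ_self)
    rwa [le_div_iff₀ (by positivity), zero_mul] at h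
  set m := max L (s.sup id)
  have hs : s ⊆ insert 0 (Finset.Icc 1 L ∪ Finset.Ioc L m) := fun n hn => by
    have hnm : n ≤ m := (Finset.le_sup (f := id) hn).trans (le_max_right _ _)
    simp only [Finset.mem_insert, Finset.mem_union, Finset.mem_Icc, Finset.mem_Ioc]
    lia
  have hdisj : Disjoint (Finset.Icc 1 L) (Finset.Ioc L m) := by
    rw [Finset.disjoint_left]
    intro n hn hn'
    exact (Finset.mem_Icc.1 hn).2.not_gt (Finset.mem_Ioc.1 hn').1
  calc ∑ n ∈ s, f n ≤ ∑ n ∈ insert 0 (Finset.Icc 1 L ∪ Finset.Ioc L m), f n :=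
        Finset.sum_le_sum_of_subset_of_nonneg hs fun n _ _ => hf n
    _ = ∑ n ∈ Finset.Icc 1 L, f n + ∑ n ∈ Finset.Ioc L m, f n := by
        rw [Finset.sum_insert_zero h0, Finset.sum_union hdisj]
    _ ≤ ∑ n ∈ Finset.Icc 1 L, f n + ∑ n ∈ Finset.Ioc L m, A * ((n : ℝ) ^ 2)⁻¹ := by
        gcongr with n hn
        exact htail n (Finset.mem_Ioc.1 hn).1
    _ ≤ ∑ n ∈ Finset.Icc 1 L, f n + A / L := by
        rw [← Finset.mul_sum, div_eq_mul_inv]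
        gcongr
        exact (sum_Ioc_inv_sq_le_sub (Nat.one_le_iff_ne_zero.1 hL) (le_max_left _ _)).trans
          (sub_le_self _ (by positivity))

/-- The Fourier coefficients of a measure on the circle. -/
def measureFourierCoeff (μ : Measure UnitAddCircle) (n : ℤ) : ℂ := ∫ x, fourier (-n) x ∂μ

/-- A weighted sum of the moduli of the first `L` Fourier coefficients of `μ`, which controls the
deviation of `μ` from the uniform measure on balls of radius `r`. The weights are bounds for the
Fourier coefficients of cutoffs to such balls. -/
def fourierDiscrepancy (μ : Measure UnitAddCircle) (r : ℝ) (L : ℕ) : ℝ :=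
  ∑ n ∈ Finset.Icc 1 L, min r (1 / (r * n ^ 2)) * ‖measureFourierCoeff μ n‖

theorem fourierDiscrepancy_nonneg (μ : Measure UnitAddCircle) {r : ℝ} (hr : 0 ≤ r) (L : ℕ) :
    0 ≤ fourierDiscrepancy μ r L :=
  Finset.sum_nonneg fun n _ => mul_nonneg (le_min hr (by positivity)) (norm_nonneg _)

-- The cutoff `1 / r` is where the two terms of the minimum agree.
theorem sum_min_le {r : ℝ} (hr : 0 < r) (L : ℕ) :
    ∑ n ∈ Finset.Icc 1 L, min r (1 / (r * n ^ 2)) ≤ 3 := by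
  set P := ⌈1 / r⌉₊
  have hP : 1 / r ≤ P := Nat.le_ceil _
  have hP' : (P : ℝ) ≤ 1 / r + 1 := (Nat.ceil_lt_add_one (by positivity)).le
  have hP1 : 1 ≤ P := Nat.ceil_pos.2 (by positivity)
  set m := min r (1 / r)
  have hm : m ≤ 1 := by
    rcases le_total r 1 with h | h
    · exact (min_le_left _ _).trans h
    · exact (min_le_right _ _).trans ((div_le_one hr).2 h)
  have htail := sum_le_sum_Icc_add_div (f := fun n : ℕ => min r (1 / (r * n ^ 2))) (A := 1 / r)
    hP1 (fun n => le_min hr.le (by positivity)) (by simpa using hr.le)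
    (fun n _ => (min_le_right _ _).trans_eq (by rw [div_div])) (Finset.Icc 1 L)
  have hhead : ∑ n ∈ Finset.Icc 1 P, min r (1 / (r * (n : ℝ) ^ 2)) ≤ P * m := by
    refine (Finset.sum_le_card_nsmul _ _ m fun n hn => ?_).trans_eq (by simp)
    have hn1 : (1 : ℝ) ≤ (n : ℝ) ^ 2 := one_le_pow₀ (by exact_mod_cast (Finset.mem_Icc.1 hn).1)
    exact min_le_min_left _ (one_div_le_one_div_of_le hr (le_mul_of_one_le_right hr.le hn1))
  have hPm : P * m ≤ 2 := by
    calc P * m ≤ (1 / r + 1) * m := by gcongr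
      _ = 1 / r * m + m := by ring
      _ ≤ 1 / r * r + 1 := by
          gcongr
          exact min_le_left _ _
      _ = 2 := by field_simp; norm_num
  have hPr : 1 / r / P ≤ 1 := (div_le_one (by positivity)).2 hP
  linarith

section Measure

variable (μ : Measure UnitAddCircle) [IsProbabilityMeasure μ]

theorem integrable_of_continuous {E : Type*} [NormedAddCommGroup E] {f : UnitAddCircle → E}
    (hf : Continuous f) : Integrable f μ :=
  hf.integrable_of_hasCompactSupport (HasCompactSupport.of_compactSpace f)

theorem integrable_trapezoid (r s : ℝ) (q : UnitAddCircle) :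
    Integrable (fun x => trapezoid r s ‖x - q‖) μ :=
  integrable_of_continuous μ ((continuous_trapezoid r s).comp (by fun_prop))

theorem norm_measureFourierCoeff_le_one (n : ℤ) : ‖measureFourierCoeff μ n‖ ≤ 1 := by
  refine (norm_integral_le_of_norm_le_const (C := 1) (.of_forall fun x => ?_)).trans_eq (by simp)
  exact (Circle.norm_coe _).le

theorem abs_integral_re_fourier_sub_le (n : ℤ) (q : UnitAddCircle) :
    |∫ x, (fourier (-n) (x - q)).re ∂μ| ≤ ‖measureFourierCoeff μ n‖ := by
  have hsplit (x : UnitAddCircle) : fourier (-n) (x - q) = fourier (-n) x * fourier n q := by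
    simp [fourier_apply, sub_eq_add_neg, AddCircle.toCircle_add]
  have hint : Integrable (fun x => fourier (-n) (x - q)) μ :=
    integrable_of_continuous μ (by fun_prop)
  calc |∫ x, (fourier (-n) (x - q)).re ∂μ| = |(∫ x, fourier (-n) (x - q) ∂μ).re| :=
        congrArg _ (integral_re hint)
    _ ≤ ‖∫ x, fourier (-n) (x - q) ∂μ‖ := Complex.abs_re_le_norm _
    _ = ‖measureFourierCoeff μ n‖ := by
        simp only [hsplit]
        rw [integral_mul_const, norm_mul, fourier_apply, Circle.norm_coe, mul_one,
          measureFourierCoeff]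

theorem hasSum_integral_trapezoid {r s : ℝ} (hr : 0 ≤ r) (hrs : r < s) (hs : s ≤ 1 / 2)
    (q : UnitAddCircle) :
    HasSum (fun n : ℕ => trapezoidCoeff r s n * ∫ x, (fourier (-n : ℤ) (x - q)).re ∂μ)
      (∫ x, trapezoid r s ‖x - q‖ ∂μ - (r + s)) := by
  have hpoint (x : UnitAddCircle) : HasSum
      (fun n : ℕ => trapezoidCoeff r s n * (fourier (-n : ℤ) (x - q)).re)
      (trapezoid r s ‖x - q‖ - (r + s)) := by
    simpa only [cos_two_pi_mul_norm] using
      hasSum_trapezoidCoeff_mul_cos hr hrs hs (norm_nonneg (x - q)) (norm_unitAddCircle_le _)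
  have hnorm (n : ℕ) (x : UnitAddCircle) :
      ‖trapezoidCoeff r s n * (fourier (-n : ℤ) (x - q)).re‖ ≤ 1 / (s - r) / n ^ 2 := by
    rw [norm_mul]
    refine (mul_le_of_le_one_right (norm_nonneg _) ?_).trans (abs_trapezoidCoeff_le_div_sq hrs n)
    exact (Complex.abs_re_le_norm _).trans_eq (Circle.norm_coe _)
  have hint (n : ℕ) :
      Integrable (fun x => trapezoidCoeff r s n * (fourier (-n : ℤ) (x - q)).re) μ :=
    integrable_of_continuous μ (by fun_prop)
  have hsummable : Summable fun n : ℕ => 1 / (s - r) / (n : ℝ) ^ 2 := by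
    simpa only [div_eq_mul_inv] using
      (Real.summable_nat_pow_inv.2 one_lt_two).mul_left (1 / (s - r))
  have hsum := hasSum_integral_of_summable_integral_norm hint <|
    hsummable.of_nonneg_of_le (fun n => integral_nonneg fun x => norm_nonneg _) fun n =>
      (integral_mono_of_nonneg (.of_forall fun x => norm_nonneg _) (integrable_const _)
        (.of_forall (hnorm n))).trans_eq (by simp)
  simp only [integral_const_mul, (hpoint _).tsum_eq] at hsum
  rwa [integral_sub (integrable_trapezoid μ r s q) (integrable_const _), integral_const,
    probReal_univ, one_smul] at hsum

theorem abs_integral_trapezoid_sub_le {r s : ℝ} (hr : 0 ≤ r) (hrs : r < s) (hs : s ≤ 1 / 2)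
    {L : ℕ} (hL : 1 ≤ L) (q : UnitAddCircle) :
    |∫ x, trapezoid r s ‖x - q‖ ∂μ - (r + s)| ≤
      ∑ n ∈ Finset.Icc 1 L, |trapezoidCoeff r s n| * ‖measureFourierCoeff μ n‖ +
        1 / (s - r) / L := by
  refine le_of_tendsto (hasSum_integral_trapezoid μ hr hrs hs q).abs (.of_forall fun t => ?_)
  refine le_trans ?_ (sum_le_sum_Icc_add_div hL
    (f := fun n : ℕ => |trapezoidCoeff r s n| * ‖measureFourierCoeff μ n‖)
    (fun n => by positivity) (by simp [trapezoidCoeff_zero])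
    (fun n _ => (mul_le_of_le_one_right (abs_nonneg _) (norm_measureFourierCoeff_le_one μ n)).trans
      (abs_trapezoidCoeff_le_div_sq hrs n)) t)
  refine (Finset.abs_sum_le_sum_abs _ _).trans (Finset.sum_le_sum fun n _ => ?_)
  rw [abs_mul]
  gcongr
  exact abs_integral_re_fourier_sub_le μ n q

theorem abs_integral_trapezoid_sub_le_fourierDiscrepancy {r δ a b : ℝ} (hr : 0 < r) (hδ : 0 < δ)
    (hδ1 : δ ≤ 1) (ha : 0 ≤ a) (hab : b - a = δ * r) (hab' : a + b ≤ 3 * r) (hb : b ≤ 1 / 2)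
    {L : ℕ} (hL : 1 ≤ L) (q : UnitAddCircle) :
    |∫ x, trapezoid a b ‖x - q‖ ∂μ - (a + b)| ≤
      6 / δ * fourierDiscrepancy μ r L + 1 / (δ * r * L) := by
  have hlt : a < b := by linarith [mul_pos hδ hr]
  have hcoeff (n : ℕ) : |trapezoidCoeff a b n| ≤ 6 / δ * min r (1 / (r * n ^ 2)) := by
    rw [mul_min_of_nonneg _ _ (by positivity)]
    refine le_min ((abs_trapezoidCoeff_le ha hlt n).trans ?_)
      ((abs_trapezoidCoeff_le_div_sq hlt n).trans ?_)
    · calc 2 * (a + b) ≤ 6 * r := by linarith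
        _ ≤ 6 / δ * r := by
          gcongr
          exact le_div_self (by norm_num) hδ hδ1
    · calc 1 / (b - a) / n ^ 2 = 1 / δ * (1 / (r * n ^ 2)) := by rw [hab]; ring
        _ ≤ 6 / δ * (1 / (r * n ^ 2)) := by
          gcongr
          norm_num
  refine (abs_integral_trapezoid_sub_le μ ha hlt hb hL q).trans ?_
  rw [hab, div_div, fourierDiscrepancy, Finset.mul_sum]
  simp only [← mul_assoc]
  gcongr with n
  exact hcoeff n

theorem measureReal_ball_le_integral_trapezoid {r s : ℝ} (hrs : r < s) (q : UnitAddCircle) :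
    μ.real (Metric.ball q r) ≤ ∫ x, trapezoid r s ‖x - q‖ ∂μ := by
  rw [← integral_indicator_one measurableSet_ball]
  refine integral_mono_of_nonneg (.of_forall fun x => Set.indicator_nonneg (by simp) x)
    (integrable_trapezoid μ r s q) (.of_forall (Set.indicator_le' (fun x hx => ?_) fun x _ => ?_))
  · exact (trapezoid_eq_one hrs (mem_ball_iff_norm.1 hx).le).ge
  · exact trapezoid_nonneg hrs _

theorem integral_trapezoid_le_measureReal_ball {r s : ℝ} (hrs : r < s) (q : UnitAddCircle) :
    ∫ x, trapezoid r s ‖x - q‖ ∂μ ≤ μ.real (Metric.ball q s) := by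
  rw [← integral_indicator_one measurableSet_ball]
  refine integral_mono_of_nonneg (.of_forall fun x => trapezoid_nonneg hrs _)
    ((integrable_const 1).indicator measurableSet_ball)
    (.of_forall (Set.le_indicator (fun x _ => ?_) fun x hx => ?_))
  · exact trapezoid_le_one hrs _
  · exact (trapezoid_eq_zero hrs (not_lt.1 fun h => hx (mem_ball_iff_norm.2 h))).le

theorem volume_real_ball (q : UnitAddCircle) {r : ℝ} (hr : 0 ≤ r) :
    volume.real (Metric.ball q r) = min 1 (2 * r) := by
  rw [Measure.real, ← measure_congr AddCircle.closedBall_ae_eq_ball, AddCircle.volume_closedBall,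
    ENNReal.toReal_ofReal (by positivity)]

theorem ball_eq_univ (q : UnitAddCircle) {r : ℝ} (hr : 1 / 2 < r) : Metric.ball q r = Set.univ :=
  Set.eq_univ_of_forall fun _ => mem_ball_iff_norm.2 ((norm_unitAddCircle_le _).trans_lt hr)

theorem abs_measureReal_ball_sub_volume_le {r δ : ℝ} (hr : 0 < r) (hδ : 0 < δ) (hδ1 : δ ≤ 1)
    {L : ℕ} (hL : 1 ≤ L) (q : UnitAddCircle) :
    |μ.real (Metric.ball q r) - volume.real (Metric.ball q r)| ≤
      2 * δ * r + 6 / δ * fourierDiscrepancy μ r L + 1 / (δ * r * L) := by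
  have hδr : 0 < δ * r := mul_pos hδ hr
  have hδr' : δ * r ≤ r := mul_le_of_le_one_left hr.le hδ1
  have herr : 0 ≤ 6 / δ * fourierDiscrepancy μ r L + 1 / (δ * r * L) :=
    add_nonneg (mul_nonneg (by positivity) (fourierDiscrepancy_nonneg μ hr.le L)) (by positivity)
  rw [volume_real_ball q hr.le, abs_sub_le_iff]
  constructor
  · rcases le_or_gt (r + δ * r) (1 / 2) with h | h
    · have hball := measureReal_ball_le_integral_trapezoid μ (lt_add_of_pos_right r hδr) q
      have htrap := abs_integral_trapezoid_sub_le_fourierDiscrepancy μ hr hδ hδ1 hr.le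
        (add_sub_cancel_left r (δ * r)) (by linarith) h hL q
      rw [min_eq_right (by linarith)]
      linarith [(abs_le.1 htrap).2]
    · have hmin : 1 - 2 * δ * r ≤ min 1 (2 * r) := le_min (by linarith) (by linarith)
      linarith [measureReal_le_one (μ := μ) (s := Metric.ball q r)]
  · rcases le_or_gt r (1 / 2) with h | h
    · have hball := integral_trapezoid_le_measureReal_ball μ (sub_lt_self r hδr) q
      have htrap := abs_integral_trapezoid_sub_le_fourierDiscrepancy μ hr hδ hδ1 (sub_nonneg.2 hδr')
        (sub_sub_cancel r (δ * r)) (by linarith) h hL q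
      linarith [(abs_le.1 htrap).1, min_le_right 1 (2 * r)]
    · rw [ball_eq_univ q h, probReal_univ]
      linarith [min_le_left 1 (2 * r)]

end Measure

/-! ### Position densities of eigenstates -/

theorem isProbabilityMeasure_positionMeasure {N : ℕ} (κ : ℝ × ℝ) {Ψ : ℤ → ℂ}
    (hΨ : stateInner N Ψ Ψ = 1) : IsProbabilityMeasure (positionMeasure N κ Ψ) := by
  have hmass : ∑ k ∈ Finset.Icc 1 N, ‖Ψ k‖ ^ 2 / N = 1 := by
    simp only [stateInner, Complex.mul_conj'] at hΨ
    rw [one_div_mul_eq_div] at hΨ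
    rw [← Finset.sum_div]
    exact_mod_cast hΨ
  constructor
  rw [positionMeasure, Measure.finsetSum_apply]
  simp only [Measure.smul_apply, measure_univ, smul_eq_mul, mul_one]
  rw [← ENNReal.ofReal_sum_of_nonneg fun k _ => by positivity, hmass, ENNReal.ofReal_one]

theorem measureFourierCoeff_positionMeasure (N : ℕ) (κ : ℝ × ℝ) (Ψ : ℤ → ℂ) (n : ℤ) :
    measureFourierCoeff (positionMeasure N κ Ψ) n = stateInner N (shiftOp N κ ![0, n] Ψ) Ψ := by
  rw [measureFourierCoeff, positionMeasure, integral_finsetSum_measure fun k _ =>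
    (integrable_of_continuous _ (by fun_prop)).smul_measure ENNReal.ofReal_ne_top, stateInner,
    Finset.mul_sum]
  refine Finset.sum_congr rfl fun k _ => ?_
  rw [integral_smul_measure, integral_dirac, ENNReal.toReal_ofReal (by positivity), shiftOp_apply,
    fourier_coe_apply]
  simp only [Matrix.cons_val_zero, Matrix.cons_val_one, Matrix.cons_val_fin_one, add_zero]
  rw [mul_assoc (Complex.exp _), Complex.mul_conj', Complex.real_smul]
  push_cast
  ring_nf

theorem sum_norm_le_sqrt_card_mul {ι : Type*} (s : Finset ι) (f : ι → ℂ) :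
    ∑ j ∈ s, ‖f j‖ ≤ √(s.card * ∑ j ∈ s, ‖f j‖ ^ 2) :=
  Real.le_sqrt_of_sq_le sq_sum_le_card_mul_sum_sq

theorem exists_eventually_sum_fourierDiscrepancy_le {M : Matrix.SpecialLinearGroup (Fin 2) ℤ}
    (hM : 2 < |Matrix.trace (M : Matrix (Fin 2) (Fin 2) ℤ)|) {ε : ℤˣ} {a b c : ℝ}
    (hgen : IsGenerator M ε a b c) :
    ∃ C : ℝ, ∀ᶠ N : ℕ in atTop, ∀ κ φ, IsEigenbasis N ε a b c κ φ → ∀ r > 0,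
      ∑ j, fourierDiscrepancy (positionMeasure N κ (φ j)) r N.sqrt ≤ C * N / √(Real.log N) := by
  obtain ⟨C, hC, hvariance⟩ := exists_eventually_sum_norm_sq_stateInner_le hM hgen
  refine ⟨3 * √C, ?_⟩
  filter_upwards [hvariance] with N hvariance κ φ hφ r hr
  have hmean (n : ℕ) (hn : n ∈ Finset.Icc 1 N.sqrt) :
      ∑ j, ‖measureFourierCoeff (positionMeasure N κ (φ j)) n‖ ≤ √C * N / √(Real.log N) := by
    obtain ⟨hn1, hnN⟩ := Finset.mem_Icc.1 hn
    have hvar := hvariance κ φ hφ n (by positivity) (by exact_mod_cast Nat.le_sqrt'.1 hnN)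
    simp only [measureFourierCoeff_positionMeasure]
    calc ∑ j, ‖stateInner N (shiftOp N κ ![0, n] (φ j)) (φ j)‖
        ≤ √(N * (C * N / Real.log N)) := by
          refine (sum_norm_le_sqrt_card_mul _ _).trans (Real.sqrt_le_sqrt ?_)
          rw [Finset.card_univ, Fintype.card_fin]
          gcongr
      _ = √C * N / √(Real.log N) := by
          rw [show N * (C * N / Real.log N) = C * (N : ℝ) ^ 2 / Real.log N by ring,
            Real.sqrt_div (by positivity), Real.sqrt_mul hC.le, Real.sqrt_sq (by positivity)]
  calc ∑ j, fourierDiscrepancy (positionMeasure N κ (φ j)) r N.sqrt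
      = ∑ n ∈ Finset.Icc 1 N.sqrt, min r (1 / (r * n ^ 2)) *
          ∑ j, ‖measureFourierCoeff (positionMeasure N κ (φ j)) n‖ := by
        simp only [fourierDiscrepancy, Finset.mul_sum]
        exact Finset.sum_comm
    _ ≤ ∑ n ∈ Finset.Icc 1 N.sqrt, min r (1 / (r * n ^ 2)) * (√C * N / √(Real.log N)) := by
        gcongr with n hn
        exact hmean n hn
    _ ≤ 3 * (√C * N / √(Real.log N)) := by
        rw [← Finset.sum_mul]
        gcongr
        exact sum_min_le hr _
    _ = 3 * √C * N / √(Real.log N) := by ring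

/-! ### Selection of the equidistributed eigenstates -/

/-- The geometric mean of the radius `r` and of the average size `(log N) ^ (-1 / 2)` of the
discrepancies. -/
def discrepancyThreshold (r : ℝ) (N : ℕ) : ℝ := √(r / √(Real.log N))

theorem discrepancyThreshold_eq_div_sqrt {r : ℝ} {N : ℕ} (hr : 0 < r * √(Real.log N)) :
    discrepancyThreshold r N = r / √(r * √(Real.log N)) := by
  have hlog : 0 < √(Real.log N) := (Real.sqrt_nonneg _).lt_of_ne fun h => by simp [← h] at hr
  have hr0 : 0 < r := pos_of_mul_pos_left hr hlog.le
  rw [discrepancyThreshold, eq_div_iff (Real.sqrt_pos.2 hr).ne', ← Real.sqrt_mul (by positivity),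
    show r / √(Real.log N) * (r * √(Real.log N)) = r ^ 2 by field_simp, Real.sqrt_sq hr0.le]

theorem card_filter_lt_mul_le_sum {ι : Type*} (s : Finset ι) {f : ι → ℝ} (hf : ∀ j ∈ s, 0 ≤ f j)
    (A : ℝ) : (s.filter fun j => A < f j).card * A ≤ ∑ j ∈ s, f j := by
  rw [← nsmul_eq_mul]
  exact (Finset.card_nsmul_le_sum _ _ A fun j hj => (Finset.mem_filter.1 hj).2.le).trans
    (Finset.sum_le_sum_of_subset_of_nonneg (Finset.filter_subset _ _) fun j hj _ => hf j hj)

theorem one_sub_le_card_filter_le_div {N : ℕ} (hN : 1 ≤ N) {f : Fin N → ℝ} (hf : ∀ j, 0 ≤ f j)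
    {A B : ℝ} (hA : 0 < A) (hB : ∑ j, f j ≤ B) :
    1 - B / (A * N) ≤ ((Finset.univ.filter fun j => f j ≤ A).card : ℝ) / N := by
  have hN0 : (0 : ℝ) < N := by exact_mod_cast hN
  have hmarkov := (card_filter_lt_mul_le_sum Finset.univ (fun j _ => hf j) A).trans hB
  have hcard : ((Finset.univ.filter fun j => f j ≤ A).card : ℝ) +
      (Finset.univ.filter fun j => A < f j).card = N := by
    have h := Finset.card_filter_add_card_filter_not (s := Finset.univ) fun j => f j ≤ A
    simp only [not_le, Finset.card_univ, Fintype.card_fin] at h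
    exact_mod_cast h
  rw [← le_div_iff₀ hA] at hmarkov
  rw [← div_div, ← div_self hN0.ne', ← sub_div]
  gcongr
  linarith

theorem tendsto_card_fourierDiscrepancy_le_div {M : Matrix.SpecialLinearGroup (Fin 2) ℤ}
    (hM : 2 < |Matrix.trace (M : Matrix (Fin 2) (Fin 2) ℤ)|) {ε : ℤˣ} {a b c : ℝ}
    (hgen : IsGenerator M ε a b c) {κ : ℕ → ℝ × ℝ} {φ : (N : ℕ) → Fin N → ℤ → ℂ}
    (hφ : ∀ N, 1 ≤ N → IsEigenbasis N ε a b c (κ N) (φ N)) {r : ℕ → ℝ}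
    (hr : Tendsto (fun N => r N * √(Real.log N)) atTop atTop) :
    Tendsto (fun N => ((Finset.univ.filter fun j =>
      fourierDiscrepancy (positionMeasure N (κ N) (φ N j)) (r N) N.sqrt ≤
        discrepancyThreshold (r N) N).card : ℝ) / N) atTop (𝓝 1) := by
  obtain ⟨C, hmean⟩ := exists_eventually_sum_fourierDiscrepancy_le hM hgen
  have hlower : Tendsto (fun N => 1 - C / √(r N * √(Real.log N))) atTop (𝓝 1) := by
    simpa using ((Real.tendsto_sqrt_atTop.comp hr).const_div_atTop C).const_sub 1
  refine tendsto_of_tendsto_of_tendsto_of_le_of_le' hlower tendsto_const_nhds ?_ ?_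
  · filter_upwards [hmean, hr.eventually_gt_atTop 0, eventually_ge_atTop 2] with N hmean hrN hN
    have hlog : 0 < √(Real.log N) := Real.sqrt_pos.2 (Real.log_pos (by exact_mod_cast hN))
    have hr0 : 0 < r N := pos_of_mul_pos_left hrN hlog.le
    have hdensity := one_sub_le_card_filter_le_div (by lia)
      (fun j => fourierDiscrepancy_nonneg (positionMeasure N (κ N) (φ N j)) hr0.le N.sqrt)
      (A := discrepancyThreshold (r N) N) (Real.sqrt_pos.2 (by positivity))
      (hmean _ _ (hφ N (by lia)) _ hr0)
    have hratio : C * N / √(Real.log N) / (discrepancyThreshold (r N) N * N) =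
        C / √(r N * √(Real.log N)) := by
      rw [discrepancyThreshold_eq_div_sqrt hrN, eq_div_iff (Real.sqrt_pos.2 hrN).ne']
      field_simp
      rw [Real.sq_sqrt (by positivity)]
      ring
    rwa [hratio] at hdensity
  · filter_upwards [eventually_ge_atTop 1] with N hN
    rw [div_le_one (by exact_mod_cast hN)]
    exact_mod_cast (Finset.card_le_univ _).trans_eq (Fintype.card_fin N)

theorem tendsto_log_natCast : Tendsto (fun N : ℕ => Real.log N) atTop atTop :=
  Real.tendsto_log_atTop.comp tendsto_natCast_atTop_atTop

theorem eventually_log_le_mul_sqrt {η : ℝ} (hη : 0 < η) :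
    ∀ᶠ N : ℕ in atTop, Real.log N ≤ η * N.sqrt := by
  have hlog := (isLittleO_log_rpow_atTop (r := 1 / 2) (by norm_num)).bound (half_pos hη)
  filter_upwards [tendsto_natCast_atTop_atTop.eventually hlog, eventually_ge_atTop 1] with N hlog hN
  rw [← Real.sqrt_eq_rpow, Real.norm_of_nonneg (Real.sqrt_nonneg _)] at hlog
  have hsqrt : √(N : ℝ) ≤ N.sqrt + 1 := Real.real_sqrt_le_nat_sqrt_succ
  have hsqrt1 : (1 : ℝ) ≤ N.sqrt := by exact_mod_cast Nat.sqrt_pos.2 hN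
  calc Real.log N ≤ η / 2 * √N := (Real.le_norm_self _).trans hlog
    _ ≤ η / 2 * (N.sqrt + N.sqrt) := by
        gcongr
        linarith
    _ = η * N.sqrt := by ring

theorem eventually_error_le {r : ℕ → ℝ}
    (hr : Tendsto (fun N => r N * √(Real.log N)) atTop atTop) {η : ℝ} (hη : 0 < η) :
    ∀ᶠ N in atTop, 0 < r N ∧ 6 / η * discrepancyThreshold (r N) N ≤ η * r N ∧
      1 / (η * r N * N.sqrt) ≤ η * r N := by
  filter_upwards [hr.eventually_ge_atTop 1, eventually_ge_atTop 1,
    (Real.tendsto_sqrt_atTop.comp hr).eventually_ge_atTop (6 / η ^ 2),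
    eventually_log_le_mul_sqrt (pow_pos hη 2)] with N hr1 hN hlarge hsqrt
  have hlog : 0 ≤ Real.log N := Real.log_natCast_nonneg N
  have hsqrt0 : (0 : ℝ) < N.sqrt := by exact_mod_cast Nat.sqrt_pos.2 hN
  have hr0 : 0 < r N := pos_of_mul_pos_left (zero_lt_one.trans_le hr1) (Real.sqrt_nonneg _)
  refine ⟨hr0, ?_, ?_⟩
  · have hx : 0 < √(r N * √(Real.log N)) := Real.sqrt_pos.2 (zero_lt_one.trans_le hr1)
    rw [Function.comp_apply, div_le_iff₀ (by positivity)] at hlarge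
    rw [discrepancyThreshold_eq_div_sqrt (zero_lt_one.trans_le hr1), div_mul_div_comm,
      div_le_iff₀ (by positivity)]
    calc 6 * r N ≤ √(r N * √(Real.log N)) * η ^ 2 * r N := by gcongr
      _ = η * r N * (η * √(r N * √(Real.log N))) := by ring
  · rw [div_le_iff₀ (by positivity)]
    calc 1 ≤ (r N * √(Real.log N)) ^ 2 := one_le_pow₀ hr1
      _ = r N ^ 2 * Real.log N := by rw [mul_pow, Real.sq_sqrt hlog]
      _ ≤ r N ^ 2 * (η ^ 2 * N.sqrt) := by gcongr
      _ = η * r N * (η * r N * N.sqrt) := by ring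

theorem eventually_abs_measureReal_ball_sub_volume_le {r : ℕ → ℝ}
    (hr : Tendsto (fun N => r N * √(Real.log N)) atTop atTop) {δ : ℝ} (hδ : 0 < δ) :
    ∀ᶠ N in atTop, ∀ (μ : Measure UnitAddCircle) [IsProbabilityMeasure μ],
      fourierDiscrepancy μ (r N) N.sqrt ≤ discrepancyThreshold (r N) N → ∀ q : UnitAddCircle,
      |μ.real (Metric.ball q (r N)) - volume.real (Metric.ball q (r N))| ≤ δ * r N := by
  set η := min δ 1 / 4 with hη
  have hη0 : 0 < η := by positivity
  have hη1 : η ≤ 1 := by linarith [min_le_right δ 1]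
  have hηδ : 4 * η ≤ δ := by linarith [min_le_left δ 1]
  filter_upwards [eventually_error_le hr hη0, eventually_ge_atTop 1] with
    N ⟨hr0, hthreshold, htail⟩ hN μ _ hμ q
  calc |μ.real (Metric.ball q (r N)) - volume.real (Metric.ball q (r N))|
      ≤ 2 * η * r N + 6 / η * fourierDiscrepancy μ (r N) N.sqrt + 1 / (η * r N * N.sqrt) :=
        abs_measureReal_ball_sub_volume_le μ hr0 hη0 hη1 (Nat.sqrt_pos.2 hN) q
    _ ≤ 2 * η * r N + η * r N + η * r N := by
        have hdiscrepancy := (mul_le_mul_of_nonneg_left hμ (by positivity)).trans hthreshold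
        linarith
    _ = 4 * η * r N := by ring
    _ ≤ δ * r N := by gcongr

theorem tendsto_log_rpow_neg_mul_sqrt {α : ℝ} (hα : α < 1 / 2) :
    Tendsto (fun N : ℕ => Real.log N ^ (-α) * √(Real.log N)) atTop atTop := by
  refine ((tendsto_rpow_atTop (sub_pos.2 hα)).comp tendsto_log_natCast).congr' ?_
  filter_upwards [tendsto_log_natCast.eventually_gt_atTop 0] with N hlog
  rw [Real.sqrt_eq_rpow, ← Real.rpow_add hlog, neg_add_eq_sub, Function.comp_apply]

end QuantumCat

end

theorem theorem1p1_general
    (M : Matrix.SpecialLinearGroup (Fin 2) ℤ)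
    (hM : 2 < |Matrix.trace (M : Matrix (Fin 2) (Fin 2) ℤ)|)
    (ε : ℤˣ) (a b c : ℝ) (hgen : QuantumCat.IsGenerator M ε a b c)
    (r : ℕ → ℝ) (hr : Tendsto (fun N => r N * √(Real.log N)) atTop atTop)
    (κ : ℕ → ℝ × ℝ) (φ : (N : ℕ) → Fin N → ℤ → ℂ)
    (hφ : ∀ N, 1 ≤ N → QuantumCat.IsEigenbasis N ε a b c (κ N) (φ N)) :
    ∃ S : (N : ℕ) → Finset (Fin N),
      Tendsto (fun N : ℕ => ((S N).card : ℝ) / N) atTop (𝓝 1) ∧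
      ∀ δ : ℝ, 0 < δ → ∀ᶠ N : ℕ in atTop, ∀ j ∈ S N, ∀ q : UnitAddCircle,
        |(QuantumCat.positionMeasure N (κ N) (φ N j)).real (Metric.ball q (r N)) -
          volume.real (Metric.ball q (r N))| ≤ δ * r N := by
  refine ⟨_, QuantumCat.tendsto_card_fourierDiscrepancy_le_div hM hgen hφ hr, fun δ hδ => ?_⟩
  filter_upwards [QuantumCat.eventually_abs_measureReal_ball_sub_volume_le hr hδ,
    eventually_ge_atTop 1] with N hball hN j hj q
  have := QuantumCat.isProbabilityMeasure_positionMeasure (κ N) (Ψ := φ N j)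
    (by rw [(hφ N hN).orthonormal, if_pos rfl])
  exact hball _ (Finset.mem_filter.1 hj).2 q

theorem theorem1p1
    (M : Matrix.SpecialLinearGroup (Fin 2) ℤ)
    (hM : 2 < |Matrix.trace (M : Matrix (Fin 2) (Fin 2) ℤ)|)
    (ε : ℤˣ) (a b c : ℝ) (hgen : QuantumCat.IsGenerator M ε a b c)
    (α : ℝ) (hα₀ : 0 ≤ α) (hα : α < 1 / 2)
    (κ : ℕ → ℝ × ℝ) (hκ : ∀ N, 1 ≤ N → QuantumCat.PreservesStates N ε a b c (κ N))
    (φ : (N : ℕ) → Fin N → ℤ → ℂ)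
    (hφ : ∀ N, 1 ≤ N → QuantumCat.IsEigenbasis N ε a b c (κ N) (φ N)) :
    ∃ S : (N : ℕ) → Finset (Fin N),
      Filter.Tendsto (fun N : ℕ => ((S N).card : ℝ) / N) Filter.atTop (nhds 1) ∧
      ∀ δ : ℝ, 0 < δ → ∀ᶠ N : ℕ in Filter.atTop, ∀ j ∈ S N, ∀ q : UnitAddCircle,
        |(QuantumCat.positionMeasure N (κ N) (φ N j)).real
            (Metric.ball q (Real.log N ^ (-α))) -
          MeasureTheory.volume.real (Metric.ball q (Real.log N ^ (-α)))| ≤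
        δ * Real.log N ^ (-α) := by
  exact theorem1p1_general M hM ε a b c hgen _ (QuantumCat.tendsto_log_rpow_neg_mul_sqrt hα) κ φ hφ
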